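/- Let $(R,\mathfrak m)$ be a Noetherian local ring (all rings are commutative with identity). Suppose that: (1) $R$ is analytically irreducible, i.e. its $\mathfrak m$-adic completion $\widehat R$ is an integral domain; (2) $R$ is weakly S-rational, i.e. there is at least one parameter ideal of $R$ (an ideal generated by a system of parameters: $\dim R$ elements generating an $\mathfrak m$-primary ideal) which is equal to its solid closure; (3) $R$ admits a big Cohen–Macaulay algebra, i.e. there is an $R$-algebra $B$ such that some system of parameters of $R$ is a $B$-regular sequence (in particular it does not generate the unit ideal of $B$). Then $R$ is Cohen–Macaulay, i.e. $\operatorname{depth} R=\dim R$. Here solid closure is Hochster's: an algebra $S$ over a domain $D$ is solid if $\operatorname{Hom}_D(S,D)\neq 0$; an element $z$ of a complete local domain $D$ lies in the solid closure of an ideal $I\subseteq D$ if $z\in IS$ for some solid $D$-algebra $S$; and an element $z$ of a Noetherian local ring $R$ lies in the solid closure of an ideal $I\subseteq R$ if, for every minimal prime $P$ of $\widehat R$, the image of $z$ in $D=\widehat R/P$ lies in the solid closure of $ID$. -/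

import Mathlib

universe u v

open IsLocalRing

/-- A finite sequence in a Noetherian local ring `(R, 𝔪)` is a system of parameters if it has
`dim R` members and generates an `𝔪`-primary ideal. -/
def IsSystemOfParameters (R : Type u) [CommRing R] [IsLocalRing R] (xs : List R) : Prop :=
  (xs.length : WithBot ℕ∞) = ringKrullDim R ∧ (Ideal.ofList xs).radical = maximalIdeal R

/-- A parameter ideal is an ideal generated by a system of parameters. -/
def IsParameterIdeal {R : Type u} [CommRing R] [IsLocalRing R] (I : Ideal R) : Prop :=
  ∃ xs : List R, IsSystemOfParameters R xs ∧ I = Ideal.ofList xs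

/-- The depth of a local ring: the supremum of the lengths of the regular sequences contained in
the maximal ideal. -/
noncomputable def localDepth (R : Type u) [CommRing R] [IsLocalRing R] : ℕ∞ :=
  ⨆ xs : {xs : List R // (∀ x ∈ xs, x ∈ maximalIdeal R) ∧ RingTheory.Sequence.IsRegular R xs},
    (xs.1.length : ℕ∞)

/-- A Noetherian local ring is Cohen–Macaulay if its depth equals its Krull dimension. -/
def IsCohenMacaulayLocalRing (R : Type u) [CommRing R] [IsLocalRing R] : Prop :=
  IsNoetherianRing R ∧ (localDepth R : WithBot ℕ∞) = ringKrullDim R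

/-- An `R`-algebra `B` is a big Cohen–Macaulay algebra if some system of parameters of `R` is a
`B`-regular sequence (which includes that it does not generate the unit ideal of `B`). -/
def IsBigCohenMacaulayAlgebra (R : Type u) [CommRing R] [IsLocalRing R]
    (B : Type v) [CommRing B] [Algebra R B] : Prop :=
  ∃ xs : List R, IsSystemOfParameters R xs ∧ RingTheory.Sequence.IsRegular B xs

/-- A Noetherian local ring is analytically irreducible if its completion is a domain. -/
def IsAnalyticallyIrreducible (R : Type u) [CommRing R] [IsLocalRing R] : Prop :=
  IsDomain (AdicCompletion (maximalIdeal R) R)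

/-- A module `M` over a domain `D` is solid if there is a nonzero `D`-linear map `M → D`. -/
def IsSolid (D : Type u) [CommRing D] (M : Type v) [AddCommGroup M] [Module D M] : Prop :=
  ∃ f : M →ₗ[D] D, f ≠ 0

/-- Solid closure over a complete local domain `D`: the elements `z` with `z ∈ I S` for some solid
`D`-algebra `S`. Restricting to `S` in the universe of `D` loses nothing, as `S` may be replaced by
a finitely generated subalgebra which contains the coefficients of an expression of `z` and an
element on which a given functional does not vanish. -/
def domainSolidClosure {D : Type u} [CommRing D] (I : Ideal D) : Set D :=
  {z | ∃ (S : Type u) (_ : CommRing S) (_ : Algebra D S),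
    IsSolid D S ∧ algebraMap D S z ∈ I.map (algebraMap D S)}

/-- Solid closure in a Noetherian local ring: the elements whose image lies in the solid closure of
the extended ideal over each complete local domain `R̂ / P` of `R`, where `P` is a minimal prime of
the completion `R̂`. -/
def solidClosure {R : Type u} [CommRing R] [IsLocalRing R] (I : Ideal R) : Set R :=
  {z | ∀ P ∈ minimalPrimes (AdicCompletion (maximalIdeal R) R),
    algebraMap R (AdicCompletion (maximalIdeal R) R ⧸ P) z ∈
      domainSolidClosure (I.map (algebraMap R (AdicCompletion (maximalIdeal R) R ⧸ P)))}

/-- An ideal is solidly closed if it equals its solid closure. -/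
def IsSolidlyClosed {R : Type u} [CommRing R] [IsLocalRing R] (I : Ideal R) : Prop :=
  solidClosure I = (I : Set R)

/-- A Noetherian local ring is weakly S-rational if some parameter ideal is solidly closed. -/
def IsWeaklySRational (R : Type u) [CommRing R] [IsLocalRing R] : Prop :=
  ∃ I : Ideal R, IsParameterIdeal I ∧ IsSolidlyClosed I

/-! Let `y` be a system of parameters generating the solidly closed ideal, and let `D` be the
completion of `R`. The proof rests on three facts.

Change of parameters: `y` is regular on some algebra, although only some other system is known to
be. Regular sequences on a big module need not be permutable, but after completion along the first
entry that entry can be moved anywhere (`HasRegularAlgebra.append_cons`). Cyclic rotations are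
therefore available, the last entry can be exchanged, and prime avoidance supplies a common last
entry for two systems.

Solidity: if `y` is regular on `M` over `D`, then iterating `M ↦ Mₓ / M` yields a nonzero module,
the top local cohomology of `M`, which maps nontrivially to a cogenerator `E`. By adjunction, each
localization quotient of the source becomes a Tate module of the target, so `M` has a nonzero map to
a module `ω` that plays the role of the canonical module. Completeness and the finite socle of `E`
make `ω` finite. The dimension bound makes it torsion-free, so linear forms separate its points and
`M` is solid (`exists_linearForm_ne_zero_of_isRegular`).

Descent: if `y` is regular on `B`, then `D ⊗ B` is solid, so the contraction of `(y)B` lies in the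
solid closure of `(y)`, which is `(y)`. Nakayama passes this contractedness to initial segments of
`y` (`mem_ofList_of_algebraMap_mem`), and a relation over `R`, solved in `B`, is then solved in `R`.
Hence `y` is `R`-regular. -/

open RingTheory.Sequence
open scoped Pointwise

/-! ### Derived completeness and moving an entry of a regular sequence -/

section DerivedComplete

variable {R : Type u} [CommRing R]

/-- A module `M` is derived complete with respect to `x` if every system of equations
`sᵢ = kᵢ + x sᵢ₊₁` has exactly one solution in `M`. -/
def IsDerivedComplete (x : R) (M : Type v) [AddCommGroup M] [Module R M] : Prop :=
  ∀ k : ℕ → M, ∃! s : ℕ → M, ∀ i, s i = k i + x • s (i + 1)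

variable {M : Type v} [AddCommGroup M] [Module R M]

lemma mem_smul_top_iff_exists {a : R} {m : M} :
    m ∈ a • (⊤ : Submodule R M) ↔ ∃ n, m = a • n := by
  rw [Submodule.mem_smul_pointwise_iff_exists]
  exact ⟨fun ⟨n, _, h⟩ ↦ ⟨n, h.symm⟩, fun ⟨n, h⟩ ↦ ⟨n, trivial, h.symm⟩⟩

lemma IsDerivedComplete.eq_zero {x : R} (h : IsDerivedComplete x M) {s : ℕ → M}
    (hs : ∀ i, s i = x • s (i + 1)) : s = 0 :=
  (h 0).unique (by simpa using hs) (by simp)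

/-- This stability is the reason for using derived completeness: `M / bM` may fail to be separated.
For uniqueness, lift two solutions; their defect is `b • w`, and solving the system for `w` corrects
the difference to a solution of the homogeneous system, which is zero. -/
lemma IsDerivedComplete.quotSMulTop {x : R} (h : IsDerivedComplete x M) (b : R) :
    IsDerivedComplete x (QuotSMulTop b M) := by
  intro k
  choose k' hk' using fun i ↦ Submodule.mkQ_surjective (b • (⊤ : Submodule R M)) (k i)
  obtain ⟨s, hs, -⟩ := h k'
  refine ⟨fun i ↦ Submodule.mkQ _ (s i), fun i ↦ ?_, fun t ht ↦ ?_⟩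
  · rw [← hk', ← map_smul, ← map_add, ← hs i]
  · choose t' ht' using fun i ↦ Submodule.mkQ_surjective (b • (⊤ : Submodule R M)) (t i)
    have hmem (i : ℕ) : ∃ u, t' i - s i - x • (t' (i + 1) - s (i + 1)) = b • u := by
      rw [← mem_smul_top_iff_exists, ← Submodule.Quotient.mk_eq_zero]
      change Submodule.mkQ _ _ = 0
      have h1 := ht i
      rw [← ht', ← ht', ← hk'] at h1
      have h2 : Submodule.mkQ (b • (⊤ : Submodule R M)) (s i) = _ := congrArg _ (hs i)
      simp only [map_sub, map_add, map_smul] at h1 h2 ⊢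
      rw [h1, h2]
      simp [smul_sub]
    choose w hw using hmem
    obtain ⟨c, hc, -⟩ := h w
    have hz := h.eq_zero (s := fun i ↦ t' i - s i - b • c i) fun i ↦ by
      have h1 := hw i
      rw [eq_sub_of_add_eq (hc i).symm] at h1
      simp only [smul_sub, smul_smul, mul_comm b x] at h1 ⊢
      rw [sub_eq_iff_eq_add] at h1
      rw [h1]
      abel
    ext i
    rw [← ht' i, ← sub_eq_zero, ← map_sub]
    have h1 : t' i - s i = b • c i := sub_eq_zero.mp (congrFun hz i)
    rw [h1, Submodule.mkQ_apply, Submodule.Quotient.mk_eq_zero]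
    exact mem_smul_top_iff_exists.mpr ⟨_, rfl⟩

lemma isSMulRegular_quotSMulTop_iff {a b : R} :
    IsSMulRegular (QuotSMulTop a M) b ↔ ∀ m n : M, b • m = a • n → ∃ n', m = a • n' := by
  rw [isSMulRegular_iff_right_eq_zero_of_smul]
  refine ⟨fun h m n hmn ↦ ?_, fun h q hq ↦ ?_⟩
  · rw [← mem_smul_top_iff_exists, ← Submodule.Quotient.mk_eq_zero]
    refine h _ ?_
    rw [← Submodule.Quotient.mk_smul, Submodule.Quotient.mk_eq_zero]
    exact mem_smul_top_iff_exists.mpr ⟨n, hmn⟩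
  · obtain ⟨m, rfl⟩ := Submodule.Quotient.mk_surjective _ q
    rw [← Submodule.Quotient.mk_smul, Submodule.Quotient.mk_eq_zero,
      mem_smul_top_iff_exists] at hq
    rw [Submodule.Quotient.mk_eq_zero, mem_smul_top_iff_exists]
    obtain ⟨n, hn⟩ := hq
    exact h m n hn

/-- An element killed by `b` is `a` times another element killed by `b`. Iterating gives a solution
of the homogeneous system, so the element is zero. Completeness is not needed for regularity of `a`
modulo `b`. -/
lemma IsDerivedComplete.isSMulRegular_swap {a b : R} (h : IsDerivedComplete a M)
    (ha : IsSMulRegular M a) (hb : IsSMulRegular (QuotSMulTop a M) b) :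
    IsSMulRegular M b ∧ IsSMulRegular (QuotSMulTop b M) a := by
  rw [isSMulRegular_quotSMulTop_iff] at hb
  constructor
  · rw [isSMulRegular_iff_right_eq_zero_of_smul]
    intro m hm
    have step (x : {m : M // b • m = 0}) : ∃ y : {m : M // b • m = 0}, x.1 = a • y.1 := by
      obtain ⟨y, hy⟩ := hb x.1 0 (by rw [x.2, smul_zero])
      refine ⟨⟨y, ?_⟩, hy⟩
      apply ha
      change a • (b • y) = a • 0
      rw [smul_comm, ← hy, x.2, smul_zero]
    choose f hf using step
    have h0 := h.eq_zero (s := fun i ↦ (f^[i] ⟨m, hm⟩).1) fun i ↦ by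
      rw [Function.iterate_succ_apply']
      exact hf _
    exact congrFun h0 0
  · rw [isSMulRegular_quotSMulTop_iff]
    intro m n hmn
    obtain ⟨n', rfl⟩ := hb n m hmn.symm
    refine ⟨n', ha ?_⟩
    change a • m = a • (b • n')
    rw [hmn, smul_comm]

/-- Reduction modulo two elements does not depend on their order. -/
noncomputable def quotSMulTopComm (a b : R) (M : Type v) [AddCommGroup M] [Module R M] :
    QuotSMulTop b (QuotSMulTop a M) ≃ₗ[R] QuotSMulTop a (QuotSMulTop b M) :=
  have hb (N : Type v) [AddCommGroup N] [Module R N] :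
      Ideal.ofList [b] • (⊤ : Submodule R N) = b • ⊤ := by
    rw [Ideal.ofList_singleton, Submodule.ideal_span_singleton_smul]
  (Submodule.quotEquivOfEq _ _ (hb _)).symm ≪≫ₗ
    (Submodule.quotOfListConsSMulTopEquivQuotSMulTopInner M a [b]).symm ≪≫ₗ
    Submodule.quotOfListConsSMulTopEquivQuotSMulTopOuter M a [b] ≪≫ₗ
    QuotSMulTop.congr a (Submodule.quotEquivOfEq _ _ (hb _))

/-- The first member of a regular sequence may be moved to any place if the module is derived
complete with respect to it. -/
lemma IsDerivedComplete.isRegular_append_cons {a : R} (l r : List R) (h : IsDerivedComplete a M)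
    (hr : IsRegular M (a :: (l ++ r))) : IsRegular M (l ++ a :: r) := by
  induction l generalizing M with
  | nil => exact hr
  | cons b l ih =>
    rw [isRegular_cons_iff, List.cons_append, isRegular_cons_iff] at hr
    obtain ⟨ha, hb, hr⟩ := hr
    obtain ⟨hb', ha'⟩ := h.isSMulRegular_swap ha hb
    rw [List.cons_append, isRegular_cons_iff]
    refine ⟨hb', ih (h.quotSMulTop b) ?_⟩
    rw [isRegular_cons_iff]
    exact ⟨ha', ((quotSMulTopComm a b M).isRegular_congr _).mp hr⟩

lemma span_singleton_pow_smul_top {x : R} (n : ℕ) :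
    (Ideal.span {x} ^ n • ⊤ : Submodule R M) = (x ^ n) • ⊤ := by
  rw [Ideal.span_singleton_pow, Submodule.ideal_span_singleton_smul]

lemma exists_seq_of_isAdicComplete {I : Ideal R} [IsAdicComplete I M] {x : R} (hx : x ∈ I)
    (k : ℕ → M) : ∃ s : ℕ → M, ∀ i, s i = k i + x • s (i + 1) := by
  have hpow (n : ℕ) (m : M) : x ^ n • m ∈ (I ^ n • ⊤ : Submodule R M) :=
    Submodule.smul_mem_smul (Ideal.pow_mem_pow hx n) trivial
  -- The solution is `sᵢ = ∑ xʲ kᵢ₊ⱼ`; these are its partial sums.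
  let p (i n : ℕ) : M := ∑ j ∈ Finset.range n, x ^ j • k (i + j)
  have hc (i : ℕ) : ∃ s : M, ∀ n, p i n ≡ s [SMOD (I ^ n • ⊤ : Submodule R M)] := by
    refine IsPrecomplete.prec (I := I) inferInstance fun {m n} hmn ↦ ?_
    rw [SModEq.comm, SModEq.sub_mem]
    simp only [p]
    rw [← Finset.sum_range_add_sum_Ico _ hmn, add_sub_cancel_left]
    refine Submodule.sum_mem _ fun j hj ↦ ?_
    exact Submodule.smul_mono_left (Ideal.pow_le_pow_right (Finset.mem_Ico.mp hj).1) (hpow j _)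
  choose s hs using hc
  refine ⟨s, fun i ↦ (IsHausdorff.eq_iff_smodEq (I := I)).mpr fun n ↦ ?_⟩
  have h1 : p i (n + 1) = k i + x • p (i + 1) n := by
    simp only [p, Finset.sum_range_succ', Finset.smul_sum, smul_smul, pow_zero, one_smul, add_zero]
    rw [add_comm]
    congr 1
    refine Finset.sum_congr rfl fun j _ ↦ ?_
    rw [pow_succ', add_assoc, add_comm 1 j]
  have h2 : p i (n + 1) ≡ s i [SMOD (I ^ n • ⊤ : Submodule R M)] :=
    (hs i (n + 1)).mono (Submodule.smul_mono_left (Ideal.pow_le_pow_right n.le_succ))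
  rw [h1] at h2
  exact h2.symm.trans (SModEq.rfl.add ((hs (i + 1) n).smul x))

lemma isDerivedComplete_of_isAdicComplete {I : Ideal R} [IsAdicComplete I M] {x : R}
    (hx : x ∈ I) : IsDerivedComplete x M := by
  intro k
  obtain ⟨s, hs⟩ := exists_seq_of_isAdicComplete hx k
  refine ⟨s, hs, fun t ht ↦ ?_⟩
  have hst (n i : ℕ) : t i - s i = x ^ n • (t (i + n) - s (i + n)) := by
    induction n with
    | zero => simp
    | succ n ih =>
      rw [ih, ht (i + n), hs (i + n), add_sub_add_left_eq_sub, ← smul_sub, smul_smul, pow_succ,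
        add_assoc]
  ext i
  rw [← sub_eq_zero]
  refine IsHausdorff.haus' (I := I) _ fun n ↦ ?_
  rw [SModEq.zero, hst n i]
  exact Submodule.smul_mem_smul (Ideal.pow_mem_pow hx n) trivial

lemma AdicCompletion.isSMulRegular_of_isSMulRegular {a : R} (ha : IsSMulRegular M a) :
    IsSMulRegular (AdicCompletion (Ideal.span {a}) M) a := by
  rw [isSMulRegular_iff_right_eq_zero_of_smul]
  intro m hm
  ext n
  obtain ⟨b, hb⟩ := Submodule.Quotient.mk_surjective _ (m.val (n + 1))
  have h1 : (Submodule.Quotient.mk (a • b) : M ⧸ (Ideal.span {a} ^ (n + 1) • ⊤ : Submodule R M))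
      = 0 := by
    rw [Submodule.Quotient.mk_smul, hb, ← AdicCompletion.val_smul_apply, hm]
    rfl
  rw [Submodule.Quotient.mk_eq_zero, span_singleton_pow_smul_top, mem_smul_top_iff_exists] at h1
  obtain ⟨c, hc⟩ := h1
  -- Cancelling `a` costs one power, which is why the representative was taken at level `n + 1`.
  have h2 : b = a ^ n • c := ha (by
    change a • b = a • (a ^ n • c)
    rw [hc, smul_smul, ← pow_succ'])
  rw [← AdicCompletion.transitionMap_comp_eval_apply _ _ n.le_succ]
  change AdicCompletion.transitionMap _ _ n.le_succ (m.val (n + 1)) = 0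
  rw [← hb]
  change Submodule.Quotient.mk b = 0
  rw [Submodule.Quotient.mk_eq_zero, span_singleton_pow_smul_top, h2]
  exact mem_smul_top_iff_exists.mpr ⟨_, rfl⟩

/-- Reduction modulo `a` is not changed by `a`-adic completion. -/
noncomputable def quotSMulTopAdicCompletionEquiv (a : R) (M : Type v) [AddCommGroup M]
    [Module R M] :
    QuotSMulTop a (AdicCompletion (Ideal.span {a}) M) ≃ₗ[R] QuotSMulTop a M :=
  have h : (AdicCompletion.eval (Ideal.span {a}) M 1).ker =
      a • (⊤ : Submodule R (AdicCompletion (Ideal.span {a}) M)) := by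
    rw [← AdicCompletion.pow_smul_top_eq_ker_eval (Submodule.fg_span_singleton a), pow_one,
      Submodule.ideal_span_singleton_smul]
  Submodule.quotEquivOfEq _ _ h.symm ≪≫ₗ
    LinearMap.quotKerEquivOfSurjective _ (AdicCompletion.eval_surjective _ _ 1) ≪≫ₗ
    Submodule.quotEquivOfEq _ _ (by
      rw [pow_one, Submodule.ideal_span_singleton_smul])

lemma AdicCompletion.isRegular_cons {a : R} {l : List R} (h : IsRegular M (a :: l)) :
    IsRegular (AdicCompletion (Ideal.span {a}) M) (a :: l) := by
  rw [isRegular_cons_iff] at h ⊢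
  exact ⟨AdicCompletion.isSMulRegular_of_isSMulRegular h.1,
    ((quotSMulTopAdicCompletionEquiv a M).isRegular_congr l).mpr h.2⟩

lemma isRegular_map_algebraMap_iff {S : Type*} [CommRing S] [Algebra R S] [Module S M]
    [IsScalarTower R S M] (l : List R) :
    IsRegular M (l.map (algebraMap R S)) ↔ IsRegular M l :=
  (AddEquiv.refl M).isRegular_congr (List.forall₂_map_left_iff.mpr
    (List.forall₂_same.mpr fun r _ x ↦ algebraMap_smul S r x))

end DerivedComplete

/-! ### Rotating a sequence that is regular on some algebra -/

section RegularAlgebra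

variable {R : Type u} [CommRing R]

/-- There is an algebra on which the sequence `l` is regular. -/
def HasRegularAlgebra (l : List R) : Prop :=
  ∃ (B : Type v) (_ : CommRing B) (_ : Algebra R B), IsRegular B l

/-- The `a`-adic completion of `B` keeps the sequence regular and is derived complete with respect
to `a`. The sequence is first mapped to `B` so that the completion is again an algebra. -/
lemma HasRegularAlgebra.append_cons {a : R} {l r : List R}
    (h : HasRegularAlgebra.{u, v} (a :: (l ++ r))) : HasRegularAlgebra.{u, v} (l ++ a :: r) := by
  obtain ⟨B, _, _, h⟩ := h
  rw [← isRegular_map_algebraMap_iff (S := B)] at h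
  have h' := AdicCompletion.isRegular_cons h
  have hc : IsAdicComplete (Ideal.span {algebraMap R B a})
      (AdicCompletion (Ideal.span {algebraMap R B a}) B) :=
    AdicCompletion.isAdicComplete (Submodule.fg_span_singleton _)
  have hd := isDerivedComplete_of_isAdicComplete
    (M := AdicCompletion (Ideal.span {algebraMap R B a}) B)
    (Ideal.mem_span_singleton_self (algebraMap R B a))
  rw [List.map_append] at h'
  have h'' := hd.isRegular_append_cons _ _ h'
  rw [← List.map_cons, ← List.map_append] at h''
  refine ⟨AdicCompletion (Ideal.span {algebraMap R B a}) B, inferInstance, inferInstance, ?_⟩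
  exact (isRegular_map_algebraMap_iff (S := B) _).mp h''

lemma HasRegularAlgebra.rotate {l r : List R} (h : HasRegularAlgebra.{u, v} (l ++ r)) :
    HasRegularAlgebra.{u, v} (r ++ l) := by
  induction l generalizing r with
  | nil => simpa using h
  | cons a l ih =>
    have h1 : HasRegularAlgebra.{u, v} (l ++ (r ++ [a])) := by
      rw [← List.append_assoc]
      exact HasRegularAlgebra.append_cons (r := []) (by simpa using h)
    simpa using ih h1

end RegularAlgebra

/-! ### Exchanging systems of parameters -/

section SystemOfParameters

lemma pow_smul_top_eq_top {R : Type u} [CommRing R] {M : Type*} [AddCommGroup M] [Module R M] {I : Ideal R}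
    (h : I • (⊤ : Submodule R M) = ⊤) (n : ℕ) : I ^ n • (⊤ : Submodule R M) = ⊤ := by
  induction n with
  | zero => simp
  | succ n ih => rw [pow_succ, Submodule.mul_smul, h, ih]

variable {R : Type u} [CommRing R] [IsLocalRing R]

lemma IsSystemOfParameters.mem_maximalIdeal {l : List R} (h : IsSystemOfParameters R l) {x : R}
    (hx : x ∈ l) : x ∈ maximalIdeal R :=
  h.2 ▸ Ideal.le_radical (Ideal.subset_span hx)

lemma isSystemOfParameters_of_perm {l l' : List R} (h : IsSystemOfParameters R l)
    (hp : l.Perm l') : IsSystemOfParameters R l' := by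
  refine ⟨hp.length_eq ▸ h.1, ?_⟩
  rw [← h.2]
  exact congrArg (fun s ↦ (Ideal.span s).radical) (Set.ext fun _ ↦ hp.mem_iff.symm)

variable [IsNoetherianRing R]

lemma IsSystemOfParameters.exists_pow_le {l : List R} (h : IsSystemOfParameters R l) :
    ∃ n, maximalIdeal R ^ n ≤ Ideal.ofList l := by
  obtain ⟨n, hn⟩ := Ideal.exists_radical_pow_le_of_fg (Ideal.ofList l)
    ((isNoetherianRing_iff_ideal_fg R).mp inferInstance _)
  exact ⟨n, h.2 ▸ hn⟩

/-- The last member of a system of parameters which is regular on a module may be exchanged. -/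
lemma isRegular_exchange_last {M : Type v} [AddCommGroup M] [Module R M] {l : List R} {x z : R}
    (hx : IsSystemOfParameters R (l ++ [x])) (hz : IsSystemOfParameters R (l ++ [z]))
    (h : IsRegular M (l ++ [x])) : IsRegular M (l ++ [z]) := by
  have hw := h.toIsWeaklyRegular
  rw [isWeaklyRegular_append_iff, isWeaklyRegular_singleton_iff] at hw
  refine ⟨?_, fun htop ↦ ?_⟩
  · rw [isWeaklyRegular_append_iff, isWeaklyRegular_singleton_iff]
    refine ⟨hw.1, ?_⟩
    -- Write `xⁿ = j + a z` with `j` in the ideal of `l`. Modulo `l`, whatever `z` kills is killed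
    -- by `xⁿ`, hence zero.
    have hxm : x ∈ (Ideal.ofList (l ++ [z])).radical :=
      hz.2 ▸ hx.mem_maximalIdeal (by simp)
    obtain ⟨n, hn⟩ := hxm
    rw [Ideal.ofList_append, Ideal.ofList_singleton, Submodule.mem_sup] at hn
    obtain ⟨j, hj, w, hw', hjw⟩ := hn
    obtain ⟨a, rfl⟩ := Ideal.mem_span_singleton'.mp hw'
    rw [isSMulRegular_iff_right_eq_zero_of_smul]
    intro q hq
    apply hw.2.pow n
    change x ^ n • q = x ^ n • 0
    have hjq : j • q = 0 := by
      obtain ⟨m, rfl⟩ := Submodule.Quotient.mk_surjective _ q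
      rw [← Submodule.Quotient.mk_smul, Submodule.Quotient.mk_eq_zero]
      exact Submodule.smul_mem_smul hj trivial
    rw [smul_zero, ← hjw, add_smul, hjq, mul_smul, hq, smul_zero, add_zero]
  · obtain ⟨n, hn⟩ := hx.exists_pow_le
    have hm : maximalIdeal R • (⊤ : Submodule R M) = ⊤ := by
      refine top_le_iff.mp (htop.le.trans (Submodule.smul_mono_left ?_))
      exact hz.2 ▸ Ideal.le_radical
    exact h.top_ne_smul (top_le_iff.mp
      ((pow_smul_top_eq_top hm n).ge.trans (Submodule.smul_mono_left hn))).symm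

/-- A prime strictly below the maximal ideal that contains `l` is minimal over `l`, since the
maximal ideal is minimal over `l` together with `x`. Such a prime cannot contain `z`. -/
lemma IsSystemOfParameters.exchange_last {l : List R} {x z : R}
    (hx : IsSystemOfParameters R (l ++ [x])) (hz : z ∈ maximalIdeal R)
    (hzl : ∀ q ∈ (Ideal.ofList l).minimalPrimes, z ∉ q) :
    IsSystemOfParameters R (l ++ [z]) := by
  refine ⟨by simpa using hx.1, ?_⟩
  have hlm : Ideal.ofList l ≤ maximalIdeal R :=
    Ideal.span_le.mpr fun y hy ↦ hx.mem_maximalIdeal (by simp [show y ∈ l from hy])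
  have hm : maximalIdeal R ∈ (Ideal.span (insert x {r | r ∈ l})).minimalPrimes := by
    have h1 : Ideal.span (insert x {r | r ∈ l}) = Ideal.ofList (l ++ [x]) := by
      rw [Ideal.ofList]
      congr 1
      ext y
      simp [or_comm]
    rw [h1, ← Ideal.radical_minimalPrimes, hx.2, Ideal.minimalPrimes_eq_subsingleton_self]
    rfl
  refine le_antisymm ?_ ?_
  · refine (maximalIdeal.isMaximal R).isPrime.radical_le_iff.mpr ?_
    rw [Ideal.ofList_append, Ideal.ofList_singleton]
    exact sup_le hlm ((Ideal.span_singleton_le_iff_mem _).mpr hz)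
  · rw [Ideal.radical_eq_sInf]
    refine le_sInf fun p ⟨hp, hpp⟩ ↦ ?_
    rw [Ideal.ofList_append, Ideal.ofList_singleton, sup_le_iff,
      Ideal.span_singleton_le_iff_mem] at hp
    by_contra hmp
    have hlt : p < maximalIdeal R := (le_maximalIdeal hpp.ne_top).lt_of_not_ge hmp
    have hpmin : p ∈ (Ideal.ofList l).minimalPrimes :=
      Ideal.mem_minimalPrimes_span_of_mem_minimalPrimes_span_insert hlt x {r | r ∈ l} hm _
        (fun y hy ↦ hp.1 (Ideal.subset_span hy))
        fun y hy ↦ Ideal.le_radical (Ideal.subset_span (Or.inr hy))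
    exact hzl p hpmin hp.2

/-- Otherwise Krull's height theorem would bound the dimension by the length of `l`, which is one
less. -/
lemma IsSystemOfParameters.maximalIdeal_notMem_minimalPrimes {l : List R} {x : R}
    (hx : IsSystemOfParameters R (l ++ [x])) :
    maximalIdeal R ∉ (Ideal.ofList l).minimalPrimes := by
  classical
  intro h
  have h1 : (maximalIdeal R).height ≤ (l.toFinset.card : ℕ∞) := by
    refine Ideal.height_le_card_of_mem_minimalPrimes_span_finset ?_
    simpa [Ideal.ofList] using h
  have h2 : (maximalIdeal R).height ≤ (l.length : ℕ∞) :=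
    h1.trans (by exact_mod_cast l.toFinset_card_le)
  have h3 := hx.1
  rw [← maximalIdeal_height_eq_ringKrullDim] at h3
  have h4 : ((l ++ [x]).length : ℕ∞) = (maximalIdeal R).height := by exact_mod_cast h3
  rw [← h4, List.length_append, List.length_singleton] at h2
  have : l.length + 1 ≤ l.length := by exact_mod_cast h2
  omega

/-- Prime avoidance for the finitely many minimal primes over `l` and over `l'`, none of which is
the maximal ideal. -/
lemma exists_common_exchange {l l' : List R} {x x' : R}
    (hx : IsSystemOfParameters R (l ++ [x])) (hx' : IsSystemOfParameters R (l' ++ [x'])) :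
    ∃ z, IsSystemOfParameters R (l ++ [z]) ∧ IsSystemOfParameters R (l' ++ [z]) := by
  classical
  have hf := (Ideal.finite_minimalPrimes_of_isNoetherianRing R (Ideal.ofList l)).union
    (Ideal.finite_minimalPrimes_of_isNoetherianRing R (Ideal.ofList l'))
  have hmin : ∀ q ∈ hf.toFinset, q.IsPrime ∧ ¬ maximalIdeal R ≤ q := by
    intro q hq
    rw [Set.Finite.mem_toFinset] at hq
    have hqp : q.IsPrime := hq.elim (fun h ↦ h.isPrime) (fun h ↦ h.isPrime)
    refine ⟨hqp, fun hle ↦ ?_⟩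
    have : maximalIdeal R = q := (maximalIdeal.isMaximal R).eq_of_le hqp.ne_top hle
    subst this
    exact hq.elim hx.maximalIdeal_notMem_minimalPrimes hx'.maximalIdeal_notMem_minimalPrimes
  have hnot : ¬ ((maximalIdeal R : Set R) ⊆ ⋃ q ∈ (hf.toFinset : Set (Ideal R)),
      ((id q : Ideal R) : Set R)) := by
    rw [Ideal.subset_union_prime (s := hf.toFinset) (f := id) ⊥ ⊥
      fun q hq _ _ ↦ (hmin q hq).1]
    rintro ⟨q, hq, hle⟩
    exact (hmin q hq).2 hle
  obtain ⟨z, hz, hzn⟩ := Set.not_subset.mp hnot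
  simp only [Set.mem_iUnion, not_exists, Set.Finite.coe_toFinset, id_eq] at hzn
  exact ⟨z, hx.exchange_last hz fun q hq hzq ↦ hzn q (Or.inl hq) hzq,
    hx'.exchange_last hz fun q hq hzq ↦ hzn q (Or.inr hq) hzq⟩

lemma HasRegularAlgebra.exchange_last {l : List R} {x z : R}
    (h : HasRegularAlgebra.{u, v} (l ++ [x])) (hx : IsSystemOfParameters R (l ++ [x]))
    (hz : IsSystemOfParameters R (l ++ [z])) : HasRegularAlgebra.{u, v} (l ++ [z]) := by
  obtain ⟨B, _, _, hB⟩ := h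
  exact ⟨B, inferInstance, inferInstance, isRegular_exchange_last hx hz hB⟩

/-- Induction on the number of entries outside the common prefix `p`. Replace both last entries by a
common `z`, rotate `z` into the prefix, apply the induction hypothesis, rotate `z` back to the end
and exchange it for the desired last entry. -/
lemma HasRegularAlgebra.of_isSystemOfParameters_append (n : ℕ) (p x y : List R)
    (hxn : x.length = n) (hyn : y.length = n) (hx : IsSystemOfParameters R (p ++ x))
    (hy : IsSystemOfParameters R (p ++ y)) (h : HasRegularAlgebra.{u, v} (p ++ x)) :
    HasRegularAlgebra.{u, v} (p ++ y) := by
  induction n generalizing p x y with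
  | zero =>
    rw [List.length_eq_zero_iff] at hxn hyn
    subst hxn hyn
    exact h
  | succ n ih =>
    obtain ⟨x', a, rfl⟩ := List.eq_nil_or_concat' x |>.resolve_left (by rintro rfl; simp at hxn)
    obtain ⟨y', b, rfl⟩ := List.eq_nil_or_concat' y |>.resolve_left (by rintro rfl; simp at hyn)
    rw [← List.append_assoc] at hx hy h ⊢
    obtain ⟨z, hzx, hzy⟩ := exists_common_exchange hx hy
    have perm (t : List R) : (p ++ t ++ [z]).Perm ((p ++ [z]) ++ t) := by
      simpa using! List.Perm.append_left p (List.perm_append_singleton z t)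
    have h1 : HasRegularAlgebra.{u, v} (z :: (p ++ x')) :=
      (h.exchange_last hx hzx).rotate
    have h2 : HasRegularAlgebra.{u, v} ((p ++ [z]) ++ x') := by
      simpa using! h1.append_cons
    have h3 := ih (p ++ [z]) x' y' (by simpa using hxn) (by simpa using hyn)
      (isSystemOfParameters_of_perm hzx (perm x')) (isSystemOfParameters_of_perm hzy (perm y')) h2
    have h4 : HasRegularAlgebra.{u, v} (z :: (y' ++ p)) := by
      rw [List.append_assoc] at h3
      simpa using! h3.rotate
    have h5 : HasRegularAlgebra.{u, v} (p ++ (y' ++ [z])) := by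
      have h6 := h4.append_cons
      exact HasRegularAlgebra.rotate (by simpa using! h6)
    rw [← List.append_assoc] at h5
    exact h5.exchange_last hzy hy

/-- If some system of parameters is regular on an algebra, then each system of parameters is
regular on some algebra. -/
lemma HasRegularAlgebra.of_isSystemOfParameters {x y : List R} (hx : IsSystemOfParameters R x)
    (hy : IsSystemOfParameters R y) (h : HasRegularAlgebra.{u, v} x) :
    HasRegularAlgebra.{u, v} y := by
  refine HasRegularAlgebra.of_isSystemOfParameters_append x.length [] x y rfl ?_ hx hy h
  exact_mod_cast hy.1.trans hx.1.symm

end SystemOfParameters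

/-! ### The quotient `Mₓ / M`: one step of local cohomology -/

section LocalizationQuotient

variable {R : Type u} [CommRing R]

/-- Let `0 → K → T → T → 0` be exact, the map from `T` to `T` being multiplication by `x`, where
every member of `T` is killed by a power of `x`. A sequence regular on `K` is regular on `T`. -/
lemma isRegular_of_exact_smul {K : Type*} {T : Type*} [AddCommGroup K] [Module R K]
    [AddCommGroup T] [Module R T] {x : R} (i : K →ₗ[R] T) (hi : Function.Injective i)
    (h0 : ∀ k, x • i k = 0) (hker : ∀ t : T, x • t = 0 → ∃ k, i k = t)
    (hsurj : ∀ t : T, ∃ t', t = x • t') (htors : ∀ t : T, ∃ n : ℕ, x ^ n • t = 0)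
    {l : List R} (h : IsRegular K l) : IsRegular T l := by
  induction l generalizing K T with
  | nil =>
    have := h.nontrivial
    have := hi.nontrivial
    exact IsRegular.nil R T
  | cons r l ih =>
    rw [isRegular_cons_iff] at h ⊢
    -- Induction on the power of `x` killing `t`: if `r • t = 0`, then `x • t` vanishes by
    -- induction, so `t` comes from `K`, where `r` is injective.
    have hr : ∀ t : T, r • t = 0 → t = 0 := by
      intro t ht
      obtain ⟨n, hn⟩ := htors t
      induction n generalizing t with
      | zero => simpa using hn
      | succ n ihn =>
        have hxt : x • t = 0 := ihn (x • t) (by rw [smul_comm, ht, smul_zero])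
          (by rw [smul_smul, ← pow_succ, hn])
        obtain ⟨k, rfl⟩ := hker t hxt
        rw [← map_smul, map_eq_zero_iff i hi] at ht
        rw [h.1.right_eq_zero_of_smul ht, map_zero]
    refine ⟨isSMulRegular_iff_right_eq_zero_of_smul.mpr hr,
      ih (K := QuotSMulTop r K) (T := QuotSMulTop r T) (QuotSMulTop.map r i) ?_ ?_ ?_ ?_ ?_ h.2⟩
    · rw [injective_iff_map_eq_zero]
      intro q hq
      obtain ⟨k, rfl⟩ := Submodule.Quotient.mk_surjective _ q
      rw [QuotSMulTop.map_apply_mk, Submodule.Quotient.mk_eq_zero,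
        mem_smul_top_iff_exists] at hq
      obtain ⟨t, ht⟩ := hq
      -- The element `x • t` is zero because `r` kills it, so `t` lies in the image of `K`.
      obtain ⟨k', rfl⟩ := hker t (hr _ (by rw [smul_comm, ← ht, h0]))
      rw [← map_smul] at ht
      rw [Submodule.Quotient.mk_eq_zero, mem_smul_top_iff_exists]
      exact ⟨k', hi ht⟩
    · intro q
      obtain ⟨k, rfl⟩ := Submodule.Quotient.mk_surjective _ q
      rw [QuotSMulTop.map_apply_mk, ← Submodule.Quotient.mk_smul, h0, Submodule.Quotient.mk_zero]
    · intro q hq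
      obtain ⟨t, rfl⟩ := Submodule.Quotient.mk_surjective _ q
      rw [← Submodule.Quotient.mk_smul, Submodule.Quotient.mk_eq_zero,
        mem_smul_top_iff_exists] at hq
      obtain ⟨t', ht'⟩ := hq
      obtain ⟨t'', rfl⟩ := hsurj t'
      -- Divisibility by `x` corrects `t` modulo `r` to an element truly killed by `x`.
      obtain ⟨k, hk⟩ := hker (t - r • t'') (by rw [smul_sub, ht', smul_comm, sub_self])
      refine ⟨Submodule.Quotient.mk k, ?_⟩
      rw [QuotSMulTop.map_apply_mk, hk, Submodule.Quotient.eq, mem_smul_top_iff_exists]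
      exact ⟨-t'', by simp⟩
    · intro q
      obtain ⟨t, rfl⟩ := Submodule.Quotient.mk_surjective _ q
      obtain ⟨t', rfl⟩ := hsurj t
      exact ⟨Submodule.Quotient.mk t', rfl⟩
    · intro q
      obtain ⟨t, rfl⟩ := Submodule.Quotient.mk_surjective _ q
      obtain ⟨n, hn⟩ := htors t
      exact ⟨n, by rw [← Submodule.Quotient.mk_smul, hn, Submodule.Quotient.mk_zero]⟩

/-- The quotient `Mₓ / M` of the localization of `M` at the powers of `x`. -/
abbrev LocalizationQuotient (x : R) (M : Type v) [AddCommGroup M] [Module R M] : Type max u v :=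
  LocalizedModule (Submonoid.powers x) M ⧸
    (LocalizedModule.mkLinearMap (Submonoid.powers x) M).range

variable {M : Type v} [AddCommGroup M] [Module R M]

/-- The map `m ↦ m / xⁿ` from `M` to `Mₓ / M`. -/
noncomputable def LocalizationQuotient.divPow (x : R) (n : ℕ) :
    M →ₗ[R] LocalizationQuotient x M :=
  Submodule.mkQ _ ∘ₗ LocalizedModule.divBy ⟨x ^ n, n, rfl⟩ ∘ₗ
    LocalizedModule.mkLinearMap (Submonoid.powers x) M

namespace LocalizationQuotient

lemma divPow_apply (x : R) (n : ℕ) (m : M) : divPow x n m =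
    Submodule.mkQ _ (LocalizedModule.mk m (⟨x ^ n, n, rfl⟩ : Submonoid.powers x)) := by
  simp [divPow, LocalizedModule.mkLinearMap_apply, LocalizedModule.divBy_apply,
    LocalizedModule.liftOn_mk]

lemma divPow_zero (x : R) (m : M) : divPow x 0 m = 0 := by
  rw [divPow_apply, Submodule.mkQ_apply, Submodule.Quotient.mk_eq_zero]
  refine ⟨m, ?_⟩
  rw [LocalizedModule.mkLinearMap_apply]
  congr 1
  ext
  simp

lemma smul_divPow_succ (x : R) (n : ℕ) (m : M) : x • divPow x (n + 1) m = divPow x n m := by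
  rw [divPow_apply, divPow_apply, ← map_smul]
  congr 1
  rw [LocalizedModule.smul'_mk, LocalizedModule.mk_eq]
  refine ⟨1, ?_⟩
  simp only [one_smul, Submonoid.smul_def, smul_smul]
  rw [pow_succ]

lemma exists_divPow_eq {x : R} (t : LocalizationQuotient x M) : ∃ n m, divPow x n m = t := by
  obtain ⟨q, rfl⟩ := Submodule.mkQ_surjective _ t
  induction q using LocalizedModule.induction_on with
  | h m s =>
    obtain ⟨_, n, rfl⟩ := s
    exact ⟨n, m, divPow_apply x n m⟩

lemma divPow_eq_zero_iff {x : R} (hx : IsSMulRegular M x) {n : ℕ} {m : M} :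
    divPow x n m = 0 ↔ ∃ m', m = x ^ n • m' := by
  rw [divPow_apply, Submodule.mkQ_apply, Submodule.Quotient.mk_eq_zero]
  constructor
  · rintro ⟨m', hm'⟩
    rw [LocalizedModule.mkLinearMap_apply, LocalizedModule.mk_eq] at hm'
    obtain ⟨⟨_, k, rfl⟩, hk⟩ := hm'
    refine ⟨m', hx.pow k ?_⟩
    simpa [Submonoid.smul_def] using hk.symm
  · rintro ⟨m', rfl⟩
    refine ⟨m', ?_⟩
    rw [LocalizedModule.mkLinearMap_apply, LocalizedModule.mk_eq]
    exact ⟨1, by simp [Submonoid.smul_def]⟩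

/-- The map `m ↦ m / x` identifies `M / xM` with the kernel of `x` on `Mₓ / M`, which is
`x`-divisible and `x`-power torsion. -/
lemma isRegular {x : R} {l : List R} (h : IsRegular M (x :: l)) :
    IsRegular (LocalizationQuotient x M) l := by
  rw [isRegular_cons_iff] at h
  obtain ⟨hx, hl⟩ := h
  have hle : x • (⊤ : Submodule R M) ≤ (divPow x 1 : M →ₗ[R] LocalizationQuotient x M).ker := by
    intro m hm
    obtain ⟨m', rfl⟩ := mem_smul_top_iff_exists.mp hm
    rw [LinearMap.mem_ker, divPow_eq_zero_iff hx]
    exact ⟨m', by rw [pow_one]⟩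
  refine isRegular_of_exact_smul (x := x) (Submodule.liftQ _ (divPow x 1) hle) ?_ ?_ ?_ ?_ ?_ hl
  · rw [injective_iff_map_eq_zero]
    intro q hq
    obtain ⟨m, rfl⟩ := Submodule.mkQ_surjective _ q
    rw [Submodule.mkQ_apply, Submodule.liftQ_apply, divPow_eq_zero_iff hx, pow_one] at hq
    rwa [Submodule.mkQ_apply, Submodule.Quotient.mk_eq_zero, mem_smul_top_iff_exists]
  · intro q
    obtain ⟨m, rfl⟩ := Submodule.mkQ_surjective _ q
    rw [Submodule.mkQ_apply, Submodule.liftQ_apply, smul_divPow_succ, divPow_zero]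
  · intro t ht
    obtain ⟨n, m, rfl⟩ := exists_divPow_eq t
    cases n with
    | zero => exact ⟨0, by rw [map_zero, divPow_zero]⟩
    | succ n =>
      rw [smul_divPow_succ, divPow_eq_zero_iff hx] at ht
      obtain ⟨m', rfl⟩ := ht
      refine ⟨Submodule.Quotient.mk m', ?_⟩
      rw [Submodule.liftQ_apply]
      clear hle hl
      induction n with
      | zero => simp
      | succ n ih =>
        rw [ih, pow_succ', mul_smul, map_smul _ x, smul_divPow_succ]
  · intro t
    obtain ⟨n, m, rfl⟩ := exists_divPow_eq t
    exact ⟨divPow x (n + 1) m, (smul_divPow_succ x n m).symm⟩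
  · intro t
    obtain ⟨n, m, rfl⟩ := exists_divPow_eq t
    refine ⟨n, ?_⟩
    rw [← map_smul, divPow_eq_zero_iff hx]
    exact ⟨m, rfl⟩

end LocalizationQuotient

end LocalizationQuotient

/-! ### Tate modules and the canonical module -/

section TateModule

variable {R : Type u} [CommRing R]

/-- The module of sequences `w` in `W` with `w₀ = 0` and `x wₙ₊₁ = wₙ`, that is, of linear maps
from `Rₓ / R` to `W`. -/
def tateModule (x : R) (W : Type v) [AddCommGroup W] [Module R W] : Submodule R (ℕ → W) where
  carrier := {w | w 0 = 0 ∧ ∀ n, x • w (n + 1) = w n}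
  add_mem' := fun ⟨h0, h⟩ ⟨h0', h'⟩ ↦ ⟨by simp [h0, h0'], fun n ↦ by simp [h, h']⟩
  zero_mem' := by simp
  smul_mem' := fun c w ⟨h0, h⟩ ↦ ⟨by simp [h0], fun n ↦ by
    rw [Pi.smul_apply, smul_comm, h, Pi.smul_apply]⟩

variable {W : Type v} [AddCommGroup W] [Module R W]

namespace tateModule

variable {x : R}

lemma pow_smul_apply (w : tateModule x W) (n k : ℕ) : x ^ n • w.1 (k + n) = w.1 k := by
  induction n with
  | zero => simp
  | succ n ih => rw [pow_succ, mul_smul, ← add_assoc, w.2.2, ih]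

/-- The term of index `n` of `xⁿ • w'` is the zeroth term of `w'`, which is zero. -/
lemma eq_zero_of_forall_eq_pow_smul (w : tateModule x W)
    (h : ∀ n : ℕ, ∃ w' : tateModule x W, w = x ^ n • w') : w = 0 := by
  ext n
  obtain ⟨w', rfl⟩ := h n
  have := pow_smul_apply w' n 0
  rw [zero_add] at this
  exact this.trans w'.2.1

/-- The sequence `w` without its first member, if the second one is zero. -/
def shift (w : tateModule x W) (h : w.1 1 = 0) : tateModule x W :=
  ⟨fun n ↦ w.1 (n + 1), h, fun n ↦ w.2.2 (n + 1)⟩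

lemma smul_shift (w : tateModule x W) (h : w.1 1 = 0) : x • shift w h = w := by
  ext n
  exact w.2.2 n

lemma eq_zero_of_smul_eq_zero (w : tateModule x W) (h : x • w = 0) : w = 0 := by
  ext n
  rw [← w.2.2 n]
  exact congrFun (congrArg Subtype.val h) (n + 1)

/-- The map `M → tateModule x W` which corresponds to a map `Mₓ / M → W`. -/
noncomputable def lift {M : Type*} [AddCommGroup M] [Module R M]
    (g : LocalizationQuotient x M →ₗ[R] W) : M →ₗ[R] tateModule x W :=
  LinearMap.codRestrict _ (LinearMap.pi fun n ↦ g ∘ₗ LocalizationQuotient.divPow x n) fun m ↦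
    ⟨by simp [LocalizationQuotient.divPow_zero],
      fun n ↦ by
        change x • g _ = g _
        rw [← map_smul, LocalizationQuotient.smul_divPow_succ]⟩

lemma lift_ne_zero {M : Type*} [AddCommGroup M] [Module R M]
    {g : LocalizationQuotient x M →ₗ[R] W} (hg : g ≠ 0) : lift g ≠ 0 := by
  contrapose! hg
  refine LinearMap.ext fun t ↦ ?_
  obtain ⟨n, m, rfl⟩ := LocalizationQuotient.exists_divPow_eq t
  exact congrFun (congrArg Subtype.val (LinearMap.congr_fun hg m)) n

end tateModule

/-- A form of Nakayama's lemma for separated modules over a ring which is complete with respect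
to `x`. -/
lemma le_span_of_exists_smul_add {x : R}
    (hc : ∀ k : ℕ → R, ∃ s : ℕ → R, ∀ i, s i = k i + x • s (i + 1))
    (hsep : ∀ w : W, (∀ n : ℕ, ∃ w', w = x ^ n • w') → w = 0) {N : Submodule R W} {d : ℕ}
    (g : Fin d → W) (hN : ∀ w ∈ N, ∃ (c : Fin d → R), ∃ w' ∈ N, w = ∑ i, c i • g i + x • w') :
    N ≤ Submodule.span R (Set.range g) := by
  intro w hw
  have hN' (w : N) : ∃ (c : Fin d → R) (w' : N), w.1 = ∑ i, c i • g i + x • w'.1 := by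
    obtain ⟨c, w', hw', h⟩ := hN w.1 w.2
    exact ⟨c, ⟨w', hw'⟩, h⟩
  choose c f hf using hN'
  -- Iterating `f` expands `w` as a power series in `x`; `s i 0` is the resulting coefficient of `g
  -- i`.
  choose s hs using fun i ↦ hc fun k ↦ c (f^[k] ⟨w, hw⟩) i
  have key (n : ℕ) : w - ∑ i, s i 0 • g i =
      x ^ n • ((f^[n] ⟨w, hw⟩).1 - ∑ i, s i n • g i) := by
    induction n with
    | zero => simp
    | succ n ih =>
      rw [ih, hf (f^[n] ⟨w, hw⟩), Function.iterate_succ_apply', pow_succ, mul_smul]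
      congr 1
      simp_rw [hs _ n, add_smul, Finset.sum_add_distrib, smul_sub, Finset.smul_sum, smul_assoc]
      abel
  rw [sub_eq_zero.mp (hsep _ fun n ↦ ⟨_, key n⟩)]
  exact Submodule.sum_mem _ fun i _ ↦
    Submodule.smul_mem _ _ (Submodule.subset_span (Set.mem_range_self i))

lemma fg_of_le_fg [IsNoetherianRing R] {E : Type*} [AddCommGroup E] [Module R E]
    {N N' : Submodule R E} (h : N'.FG) (hle : N ≤ N') : N.FG := by
  have : Module.Finite R N' := Module.Finite.iff_fg.mpr h
  exact isNoetherian_submodule.mp (isNoetherian_of_isNoetherianRing_of_finite R N') _ hle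

/-- Evaluation at index 1 lands in the part of `W` killed by `J` and `x`. A sequence vanishing there
is `x` times its shift, which `J` still kills, so the separated form of Nakayama lifts generators of
the image. -/
lemma tateModule.fg_torsionBySet [IsNoetherianRing R] {x : R}
    (hc : ∀ k : ℕ → R, ∃ s : ℕ → R, ∀ i, s i = k i + x • s (i + 1)) {J : Ideal R}
    (h : (Submodule.torsionBySet R W ((J ⊔ Ideal.span {x} : Ideal R) : Set R)).FG) :
    (Submodule.torsionBySet R (tateModule x W) (J : Set R)).FG := by
  set N := Submodule.torsionBySet R (tateModule x W) (J : Set R) with hN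
  let ev : tateModule x W →ₗ[R] W := LinearMap.proj 1 ∘ₗ (tateModule x W).subtype
  have hle : N.map ev ≤ Submodule.torsionBySet R W ((J ⊔ Ideal.span {x} : Ideal R) : Set R) := by
    rintro _ ⟨w, hw, rfl⟩
    rw [Submodule.mem_torsionBySet_iff]
    rintro ⟨a, ha⟩
    obtain ⟨j, hj, b, hb, rfl⟩ := Submodule.mem_sup.mp ha
    obtain ⟨c, rfl⟩ := Ideal.mem_span_singleton'.mp hb
    have h1 : j • w.1 1 = 0 :=
      congrFun (congrArg Subtype.val ((Submodule.mem_torsionBySet_iff _ _).mp hw ⟨j, hj⟩)) 1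
    have h2 : x • w.1 1 = 0 := (w.2.2 0).trans w.2.1
    change (j + c * x) • w.1 1 = 0
    rw [add_smul, h1, mul_smul, h2, smul_zero, add_zero]
  have hfg : (N.map ev).FG := fg_of_le_fg h hle
  obtain ⟨d, y, hy⟩ := Submodule.fg_iff_exists_fin_generating_family.mp hfg
  have hyN (i : Fin d) : ∃ g ∈ N, ev g = y i := by
    have : y i ∈ N.map ev := hy ▸ Submodule.subset_span (Set.mem_range_self i)
    exact this
  choose g hgN hg using hyN
  refine Submodule.fg_iff_exists_fin_generating_family.mpr ⟨d, g, le_antisymm ?_ ?_⟩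
  · rw [Submodule.span_le]
    rintro _ ⟨i, rfl⟩
    exact hgN i
  · refine le_span_of_exists_smul_add hc tateModule.eq_zero_of_forall_eq_pow_smul g fun w hw ↦ ?_
    have h1 : ev w ∈ Submodule.span R (Set.range y) := hy ▸ ⟨w, hw, rfl⟩
    obtain ⟨c, hcw⟩ := (Submodule.mem_span_range_iff_exists_fun R).mp h1
    have hw' : w - ∑ i, c i • g i ∈ N :=
      N.sub_mem hw (N.sum_mem fun i _ ↦ N.smul_mem _ (hgN i))
    have h0 : (w - ∑ i, c i • g i).1 1 = 0 := by
      change ev (w - ∑ i, c i • g i) = 0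
      simp_rw [map_sub, map_sum, map_smul, hg, hcw, sub_self]
    refine ⟨c, tateModule.shift _ h0, ?_, ?_⟩
    · rw [Submodule.mem_torsionBySet_iff] at hw' ⊢
      intro a
      ext n
      exact congrFun (congrArg Subtype.val (hw' a)) (n + 1)
    · rw [tateModule.smul_shift, add_sub_cancel]

/-- The ideals with no nonzero annihilated element are closed under products, and a power of the
product of the minimal primes lies in `J`. -/
lemma eq_zero_of_forall_minimalPrimes [IsNoetherianRing R] {J : Ideal R}
    (h : ∀ P ∈ J.minimalPrimes, ∀ w : W, (∀ a ∈ P, a • w = 0) → w = 0) {w : W}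
    (hw : ∀ a ∈ J, a • w = 0) : w = 0 := by
  classical
  have hmul (I I' : Ideal R) (hI : ∀ w : W, (∀ a ∈ I, a • w = 0) → w = 0)
      (hI' : ∀ w : W, (∀ a ∈ I', a • w = 0) → w = 0) (w : W)
      (hw : ∀ a ∈ I * I', a • w = 0) : w = 0 := by
    refine hI' w fun b hb ↦ hI _ fun a ha ↦ ?_
    rw [smul_smul]
    exact hw _ (Ideal.mul_mem_mul ha hb)
  have htop (w : W) (hw : ∀ a ∈ (1 : Ideal R), a • w = 0) : w = 0 := by
    simpa using hw 1 (by simp)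
  have hfin := Ideal.finite_minimalPrimes_of_isNoetherianRing R J
  have hprod : ∀ w : W, (∀ a ∈ ∏ P ∈ hfin.toFinset, P, a • w = 0) → w = 0 :=
    Finset.prod_induction _ (fun I : Ideal R ↦ ∀ w : W, (∀ a ∈ I, a • w = 0) → w = 0) hmul htop
      fun P hP ↦ h P (hfin.mem_toFinset.mp hP)
  have hle : ∏ P ∈ hfin.toFinset, P ≤ J.radical := by
    rw [← Ideal.sInf_minimalPrimes]
    refine le_sInf fun P hP ↦ Ideal.prod_le_inf.trans ?_
    exact Finset.inf_le (f := fun P ↦ P) (hfin.mem_toFinset.mpr hP)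
  obtain ⟨n, hn⟩ := Ideal.exists_radical_pow_le_of_fg J
    ((isNoetherianRing_iff_ideal_fg R).mp inferInstance _)
  have hpow (n : ℕ) : ∀ w : W, (∀ a ∈ (∏ P ∈ hfin.toFinset, P) ^ n, a • w = 0) → w = 0 := by
    induction n with
    | zero => simpa using! htop
    | succ n ih =>
      rw [pow_succ]
      exact hmul _ _ ih hprod
  exact hpow n w fun a ha ↦ hw a (hn (Ideal.pow_right_mono hle n ha))

lemma ringKrullDim_quotient_sup_span_singleton_add_one_le {P : Ideal R} [P.IsPrime] {x : R}
    (hx : x ∉ P) : ringKrullDim (R ⧸ (P ⊔ Ideal.span {x})) + 1 ≤ ringKrullDim (R ⧸ P) := by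
  have h1 : Ideal.Quotient.mk P x ∈ nonZeroDivisors (R ⧸ P) := by
    rw [mem_nonZeroDivisors_iff_ne_zero, ne_eq, Ideal.Quotient.eq_zero_iff_mem]
    exact hx
  have h2 := ringKrullDim_quotient_succ_le_of_nonZeroDivisor h1
  have e := DoubleQuot.quotQuotEquivQuotSup P (Ideal.span {x})
  rw [Ideal.map_span, Set.image_singleton] at e
  rwa [ringKrullDim_eq_of_ringEquiv e] at h2

/-- Over a Noetherian ring complete with respect to each member of `l`, a cogenerator `E` gives a
module `ω` with the properties of the Matlis dual of the top local cohomology for `l`. -/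
theorem exists_canonical_module [IsNoetherianRing R] (l : List R)
    (hc : ∀ x ∈ l, ∀ k : ℕ → R, ∃ s : ℕ → R, ∀ i, s i = k i + x • s (i + 1))
    (E : Type u) [AddCommGroup E] [Module R E]
    (hE : ∀ (T : Type max u v) [AddCommGroup T] [Module R T] [Nontrivial T],
      ∃ f : T →ₗ[R] E, f ≠ 0) :
    ∃ (ω : Type u) (_ : AddCommGroup ω) (_ : Module R ω),
      (∀ J : Ideal R, (Submodule.torsionBySet R E ((J ⊔ Ideal.ofList l : Ideal R) : Set R)).FG →
        (Submodule.torsionBySet R ω (J : Set R)).FG) ∧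
      (∀ J : Ideal R, ringKrullDim (R ⧸ J) < l.length →
        ∀ w : ω, (∀ a ∈ J, a • w = 0) → w = 0) ∧
      (∀ (M : Type max u v) [AddCommGroup M] [Module R M], IsRegular M l →
        ∃ f : M →ₗ[R] ω, f ≠ 0) := by
  induction l with
  | nil =>
    refine ⟨E, inferInstance, inferInstance, fun J hJ ↦ by simpa using hJ, fun J hJ w hw ↦ ?_,
      fun M _ _ h ↦ ?_⟩
    · have hJ' : J = ⊤ := by
        by_contra hne
        have := Ideal.Quotient.nontrivial_iff.mpr hne
        exact absurd hJ (not_lt.mpr (by simpa using ringKrullDim_nonneg_of_nontrivial))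
      simpa using hw 1 (hJ' ▸ trivial)
    · have := h.nontrivial
      exact hE M
  | cons x l ih =>
    obtain ⟨ω, _, _, hF, hV, hM⟩ := ih fun y hy ↦ hc y (List.mem_cons_of_mem x hy)
    refine ⟨tateModule x ω, inferInstance, inferInstance, fun J hJ ↦ ?_, fun J hJ w hw ↦ ?_,
      fun M _ _ h ↦ ?_⟩
    · refine tateModule.fg_torsionBySet (hc x List.mem_cons_self) (hF _ ?_)
      rwa [sup_assoc, ← Ideal.ofList_cons]
    · refine eq_zero_of_forall_minimalPrimes (fun P hP w hw ↦ ?_) hw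
      have := hP.isPrime
      by_cases hxP : x ∈ P
      · exact tateModule.eq_zero_of_smul_eq_zero w (hw x hxP)
      have hdim : ringKrullDim (R ⧸ (P ⊔ Ideal.span {x})) < l.length := by
        have h1 := ringKrullDim_quotient_sup_span_singleton_add_one_le hxP
        have h2 : ringKrullDim (R ⧸ P) ≤ ringKrullDim (R ⧸ J) :=
          ringKrullDim_le_of_surjective (Ideal.Quotient.factor hP.le)
            (Ideal.Quotient.factor_surjective hP.le)
        have h3 := (h1.trans h2).trans_lt hJ
        rw [List.length_cons, Nat.cast_add, Nat.cast_one] at h3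
        exact lt_of_add_lt_add_right h3
      -- Going up the sequence: `P` kills every term, and `x` kills the next term once the current
      -- one is zero. As `x ∉ P`, adjoining it lowers the dimension, so the induction hypothesis
      -- applies.
      ext n
      induction n with
      | zero => exact w.2.1
      | succ n ihn =>
        refine hV _ hdim _ fun a ha ↦ ?_
        obtain ⟨j, hj, b, hb, rfl⟩ := Submodule.mem_sup.mp ha
        obtain ⟨c, rfl⟩ := Ideal.mem_span_singleton'.mp hb
        have h1 : j • w.1 (n + 1) = 0 := congrFun (congrArg Subtype.val (hw j hj)) (n + 1)
        have h2 : x • w.1 (n + 1) = 0 := (w.2.2 n).trans ihn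
        rw [add_smul, h1, mul_smul, h2, smul_zero, add_zero]
    · obtain ⟨g, hg⟩ := hM _ (LocalizationQuotient.isRegular h)
      exact ⟨tateModule.lift g, tateModule.lift_ne_zero hg⟩

end TateModule

/-! ### A cogenerator with finitely generated socle -/

section Cogenerator

variable {R : Type u} [CommRing R]

lemma exists_maximal_submodule_notMem {Q : Type*} [AddCommGroup Q] [Module R Q] {e : Q}
    (he : e ≠ 0) : ∃ C : Submodule R Q, e ∉ C ∧ ∀ C', C < C' → e ∈ C' := by
  obtain ⟨C, -, hC⟩ := zorn_le_nonempty₀ {C : Submodule R Q | e ∉ C} (fun c hc hchain y hy ↦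
    ⟨sSup c, fun h ↦ by
      obtain ⟨C, hC, heC⟩ := (Submodule.mem_sSup_of_directed ⟨y, hy⟩ hchain.directedOn).mp h
      exact hc hC heC, fun z hz ↦ le_sSup hz⟩) ⊥ (by simpa using he)
  refine ⟨C, hC.prop, fun C' hlt ↦ ?_⟩
  by_contra h
  exact hlt.not_ge (hC.le_of_ge h hlt.le)

/-- Each nonzero module over a local ring has a map to the character module of the ring with a
given character of the residue field in its image. -/
lemma exists_linearMap_characterModule [IsLocalRing R] (c : CharacterModule (ResidueField R))
    {T : Type*} [AddCommGroup T] [Module R T] {t : T} (ht : t ≠ 0) :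
    ∃ f : T →ₗ[R] CharacterModule R, ∀ r : R, f t r = c (residue R r) := by
  let g : R →ₗ[R] T := LinearMap.toSpanSingleton R T t
  have hle : g.ker ≤ (Algebra.linearMap R (ResidueField R)).ker := by
    intro r hr
    rw [LinearMap.mem_ker, Algebra.linearMap_apply, ResidueField.algebraMap_eq,
      residue_eq_zero_iff]
    refine fun hu ↦ ht ?_
    rw [LinearMap.mem_ker, LinearMap.toSpanSingleton_apply] at hr
    exact (hu.smul_eq_zero).mp hr
  have hinj : Function.Injective (g.ker.liftQ g le_rfl) :=
    LinearMap.ker_eq_bot.mp (Submodule.ker_liftQ_eq_bot' _ _ rfl)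
  -- The cyclic module on `t` surjects onto the residue field; pull `c` back to it and extend the
  -- character to `T`. The adjoint of the extension `d` is the required map.
  obtain ⟨d, hd⟩ := CharacterModule.dual_surjective_of_injective _ hinj
    (CharacterModule.dual (g.ker.liftQ (Algebra.linearMap R (ResidueField R)) hle) c)
  refine ⟨{
    toFun := fun t ↦ CharacterModule.dual (LinearMap.toSpanSingleton R T t) d
    map_add' := fun a b ↦ by
      ext r
      simp only [CharacterModule.dual_apply]
      exact (congrArg d (smul_add r a b)).trans (map_add d _ _)
    map_smul' := fun a b ↦ by
      ext r
      exact congrArg d (show r • a • b = (a • r) • b by rw [smul_smul, smul_eq_mul, mul_comm]) }, fun r ↦ ?_⟩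
  exact DFunLike.congr_fun hd (Submodule.Quotient.mk r)

/-- Over a local ring there is a cogenerator whose socle is finitely generated. -/
theorem exists_cogenerator_fg_socle (R : Type u) [CommRing R] [IsLocalRing R] :
    ∃ (E : Type u) (_ : AddCommGroup E) (_ : Module R E),
      (∀ (T : Type v) [AddCommGroup T] [Module R T] [Nontrivial T], ∃ f : T →ₗ[R] E, f ≠ 0) ∧
      (Submodule.torsionBySet R E (maximalIdeal R : Set R)).FG := by
  obtain ⟨c, hc⟩ := CharacterModule.exists_character_apply_ne_zero_of_ne_zero
    (one_ne_zero (α := ResidueField R))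
  let e : CharacterModule R := CharacterModule.dual (Algebra.linearMap R (ResidueField R)) c
  have he : e ≠ 0 := fun h ↦ hc (by simpa [e] using! DFunLike.congr_fun h 1)
  -- Every nonzero `T` has a map to characters hitting `e`, and this survives modulo `C`. Maximality
  -- of `C` shrinks the socle of the quotient to the line through `e`.
  obtain ⟨C, heC, hC⟩ := exists_maximal_submodule_notMem (R := R) he
  refine ⟨CharacterModule R ⧸ C, inferInstance, inferInstance, fun T _ _ _ ↦ ?_, ?_⟩
  · obtain ⟨t, ht⟩ := exists_ne (0 : T)
    obtain ⟨f, hf⟩ := exists_linearMap_characterModule c ht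
    refine ⟨C.mkQ ∘ₗ f, fun h ↦ heC ?_⟩
    have h1 : f t = e := by
      ext r
      exact hf r
    rw [← h1, ← Submodule.Quotient.mk_eq_zero]
    exact LinearMap.congr_fun h t
  · have hle : Submodule.torsionBySet R (CharacterModule R ⧸ C) (maximalIdeal R : Set R) ≤
        Submodule.span R {C.mkQ e} := by
      intro q hq
      obtain ⟨a, rfl⟩ := C.mkQ_surjective q
      rw [Submodule.mem_torsionBySet_iff] at hq
      by_cases ha : a ∈ C
      · have : C.mkQ a = 0 := (Submodule.Quotient.mk_eq_zero C).mpr ha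
        rw [this]
        exact zero_mem _
      have hmem : e ∈ C ⊔ Submodule.span R {a} := by
        refine hC _ (left_lt_sup.mpr fun h ↦ ha ?_)
        exact h (Submodule.mem_span_singleton_self a)
      obtain ⟨y, hy, z, hz, hyz⟩ := Submodule.mem_sup.mp hmem
      obtain ⟨r, rfl⟩ := Submodule.mem_span_singleton.mp hz
      have hr : C.mkQ e = r • C.mkQ a := by
        rw [← hyz, map_add, map_smul, show C.mkQ y = 0 from
          (Submodule.Quotient.mk_eq_zero C).mpr hy, zero_add]
      -- A nonunit `r` would kill the socle element `a` modulo `C`, forcing `e ∈ C`.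
      have hu : IsUnit r := by
        by_contra hnu
        have h0 : r • C.mkQ a = 0 := hq ⟨r, (mem_maximalIdeal r).mpr hnu⟩
        rw [h0] at hr
        exact heC ((Submodule.Quotient.mk_eq_zero C).mp hr)
      obtain ⟨s, rfl⟩ := hu
      refine Submodule.mem_span_singleton.mpr ⟨(s⁻¹ : Rˣ), ?_⟩
      rw [hr, smul_smul, Units.inv_mul, one_smul]
    have hge : Submodule.span R {C.mkQ e} ≤
        Submodule.torsionBySet R (CharacterModule R ⧸ C) (maximalIdeal R : Set R) := by
      rw [Submodule.span_le, Set.singleton_subset_iff, SetLike.mem_coe,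
        Submodule.mem_torsionBySet_iff]
      rintro ⟨a, ha⟩
      have : a • e = 0 := by
        ext r
        change c (algebraMap R (ResidueField R) (a * r)) = 0
        rw [ResidueField.algebraMap_eq, map_mul, (residue_eq_zero_iff a).mpr ha, zero_mul, map_zero]
      change a • C.mkQ e = 0
      rw [← map_smul, this, map_zero]
    rw [le_antisymm hle hge]
    exact Submodule.fg_span_singleton _

/-- Multiplication by generators of `I` sends the elements killed by `Iⁿ⁺¹` to tuples killed by
`Iⁿ`, with kernel killed by `I`. -/
lemma fg_torsionBySet_pow [IsNoetherianRing R] {E : Type*} [AddCommGroup E] [Module R E]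
    {I : Ideal R} (h : (Submodule.torsionBySet R E (I : Set R)).FG) (n : ℕ) :
    (Submodule.torsionBySet R E ((I ^ n : Ideal R) : Set R)).FG := by
  induction n with
  | zero =>
    have : Submodule.torsionBySet R E ((I ^ 0 : Ideal R) : Set R) = ⊥ := by
      refine (Submodule.eq_bot_iff _).mpr fun e he ↦ ?_
      simpa using (Submodule.mem_torsionBySet_iff _ _).mp he ⟨1, by simp⟩
    rw [this]
    exact Submodule.fg_bot
  | succ n ih =>
    obtain ⟨d, a, ha⟩ := Submodule.fg_iff_exists_fin_generating_family.mp
      ((isNoetherianRing_iff_ideal_fg R).mp inferInstance I)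
    have haI (i : Fin d) : a i ∈ I := ha ▸ Submodule.subset_span (Set.mem_range_self i)
    let f : E →ₗ[R] (Fin d → E) := LinearMap.pi fun i ↦ LinearMap.lsmul R E (a i)
    refine Submodule.fg_of_fg_map_of_fg_inf_ker f ?_ ?_
    · have : Module.Finite R (Submodule.torsionBySet R E ((I ^ n : Ideal R) : Set R)) :=
        Module.Finite.iff_fg.mpr ih
      let g : (Fin d → Submodule.torsionBySet R E ((I ^ n : Ideal R) : Set R)) →ₗ[R]
          (Fin d → E) := LinearMap.pi fun i ↦ Submodule.subtype _ ∘ₗ LinearMap.proj i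
      have hg : g.range.FG := Module.Finite.iff_fg.mp inferInstance
      refine fg_of_le_fg hg ?_
      rintro _ ⟨e, he, rfl⟩
      have he' (i : Fin d) :
          a i • e ∈ Submodule.torsionBySet R E ((I ^ n : Ideal R) : Set R) := by
        rw [Submodule.mem_torsionBySet_iff]
        rintro ⟨b, hb⟩
        change b • a i • e = 0
        rw [smul_smul]
        refine (Submodule.mem_torsionBySet_iff _ _).mp he ⟨b * a i, ?_⟩
        rw [SetLike.mem_coe, pow_succ]
        exact Ideal.mul_mem_mul hb (haI i)
      exact ⟨fun i ↦ ⟨a i • e, he' i⟩, rfl⟩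
    · refine fg_of_le_fg h ?_
      rintro e ⟨-, he⟩
      rw [SetLike.mem_coe, LinearMap.mem_ker] at he
      rw [Submodule.mem_torsionBySet_iff]
      rintro ⟨b, hb⟩
      rw [SetLike.mem_coe, ← ha] at hb
      obtain ⟨c, rfl⟩ := (Submodule.mem_span_range_iff_exists_fun R).mp hb
      change (∑ i, c i • a i) • e = 0
      rw [Finset.sum_smul]
      refine Finset.sum_eq_zero fun i _ ↦ ?_
      have : a i • e = 0 := congrFun he i
      rw [smul_assoc, this, smul_zero]

end Cogenerator

/-! ### Solidity over a complete local domain -/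

section Solid

variable {D : Type u} [CommRing D]

/-- The linear forms on a finite torsion-free module over a domain separate its points. -/
lemma exists_linearForm_apply_ne_zero [IsDomain D] {W : Type*} [AddCommGroup W] [Module D W]
    [Module.Finite D W] (htf : ∀ c : D, c ≠ 0 → ∀ w : W, c • w = 0 → w = 0) {w : W}
    (hw : w ≠ 0) : ∃ f : W →ₗ[D] D, f w ≠ 0 := by
  let K := FractionRing D
  let j := LocalizedModule.mkLinearMap (nonZeroDivisors D) W
  have hj : j w ≠ 0 := by
    intro h
    rw [LocalizedModule.mkLinearMap_apply, ← LocalizedModule.zero_mk 1, LocalizedModule.mk_eq] at h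
    obtain ⟨s, hs⟩ := h
    refine hw (htf s (nonZeroDivisors.ne_zero s.2) w ?_)
    simpa [Submonoid.smul_def] using hs
  obtain ⟨φ, hφ⟩ : ∃ φ : LocalizedModule (nonZeroDivisors D) W →ₗ[K] K, φ (j w) ≠ 0 := by
    by_contra! hall
    exact hj ((Module.forall_dual_apply_eq_zero_iff K (j w)).mp hall)
  obtain ⟨n, g, hg⟩ := Module.Finite.exists_fin (R := D) (M := W)
  -- A common denominator for the values of `φ` on generators makes `b • φ` take values in `D`.
  obtain ⟨b, hb⟩ := IsLocalization.exist_integer_multiples_of_finite (nonZeroDivisors D)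
    fun i ↦ φ (j (g i))
  let ψ : W →ₗ[D] K := (b : D) • (φ.restrictScalars D ∘ₗ j)
  have hψ (y : W) : ψ y ∈ (Algebra.linearMap D K).range := by
    have hy : y ∈ Submodule.span D (Set.range g) := hg ▸ trivial
    have hle : Submodule.span D (Set.range g) ≤ (Algebra.linearMap D K).range.comap ψ := by
      rw [Submodule.span_le]
      rintro _ ⟨i, rfl⟩
      exact hb i
    exact hle hy
  have hinj : Function.Injective (Algebra.linearMap D K) := IsFractionRing.injective D K
  refine ⟨(LinearEquiv.ofInjective _ hinj).symm.toLinearMap ∘ₗ ψ.codRestrict _ hψ, fun h ↦ ?_⟩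
  rw [LinearMap.comp_apply, LinearEquiv.coe_coe, LinearEquiv.map_eq_zero_iff] at h
  have h' : (b : D) • φ (j w) = 0 := congrArg Subtype.val h
  rw [Algebra.smul_def, mul_eq_zero] at h'
  exact h'.elim (fun h0 ↦ by simp at h0) hφ

/-- A module over a complete local domain on which a system of parameters is regular is solid. -/
theorem exists_linearForm_ne_zero_of_isRegular [IsDomain D] [IsLocalRing D] [IsNoetherianRing D]
    [IsAdicComplete (maximalIdeal D) D] {l : List D}
    (hl : (Ideal.ofList l).radical = maximalIdeal D) (hdim : ringKrullDim D ≤ l.length)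
    (M : Type max u v) [AddCommGroup M] [Module D M] (h : IsRegular M l) :
    ∃ f : M →ₗ[D] D, f ≠ 0 := by
  obtain ⟨E, _, _, hE, hsoc⟩ := exists_cogenerator_fg_socle.{u, max u v} D
  have hc : ∀ x ∈ l, ∀ k : ℕ → D, ∃ s : ℕ → D, ∀ i, s i = k i + x • s (i + 1) := fun x hx ↦
    exists_seq_of_isAdicComplete (I := maximalIdeal D)
      (hl.le (Ideal.le_radical (Ideal.subset_span hx)))
  obtain ⟨ω, _, _, hF, hV, hM⟩ := exists_canonical_module.{u, v} l hc E hE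
  obtain ⟨n, hn⟩ := Ideal.exists_radical_pow_le_of_fg (Ideal.ofList l)
    ((isNoetherianRing_iff_ideal_fg D).mp inferInstance _)
  rw [hl] at hn
  -- Take `J = ⊥`: a power of the maximal ideal lies in the ideal of `l`, so the part of `E` killed
  -- by `l` is finitely generated.
  have hfin : Module.Finite D ω := by
    have h1 := hF ⊥ (fg_of_le_fg (fg_torsionBySet_pow hsoc n)
      (Submodule.torsionBySet_le_torsionBySet_of_subset (by simpa using! hn)))
    have h2 : Submodule.torsionBySet D ω ((⊥ : Ideal D) : Set D) = ⊤ := by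
      refine top_le_iff.mp fun w _ ↦ (Submodule.mem_torsionBySet_iff _ _).mpr ?_
      rintro ⟨a, ha⟩
      rw [SetLike.mem_coe, Ideal.mem_bot] at ha
      subst ha
      exact zero_smul D w
    exact ⟨h2 ▸ h1⟩
  -- A nonzero `c` is a nonzerodivisor of the domain, so `D / (c)` has dimension below the length of
  -- `l`.
  have htf (c : D) (hc0 : c ≠ 0) (w : ω) (hw : c • w = 0) : w = 0 := by
    refine hV (Ideal.span {c}) ?_ w fun a ha ↦ ?_
    · have h1 := (ringKrullDim_quotient_succ_le_of_nonZeroDivisor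
        (mem_nonZeroDivisors_of_ne_zero hc0)).trans hdim
      by_contra hge
      have h2 : ((l.length : WithBot ℕ∞)) + 1 ≤ l.length :=
        (add_le_add_left (not_lt.mp hge) 1).trans h1
      have h3 : l.length + 1 ≤ l.length := by exact_mod_cast h2
      omega
    · obtain ⟨b, rfl⟩ := Ideal.mem_span_singleton'.mp ha
      rw [mul_smul, hw, smul_zero]
  obtain ⟨f, hf⟩ := hM M h
  obtain ⟨m, hm⟩ : ∃ m, f m ≠ 0 := by
    by_contra! hall
    exact hf (LinearMap.ext hall)
  obtain ⟨g, hg⟩ := exists_linearForm_apply_ne_zero htf hm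
  exact ⟨g ∘ₗ f, fun h0 ↦ hg (LinearMap.congr_fun h0 m)⟩

end Solid

/-! ### Completions of Noetherian rings -/

section CompletionNoetherian

namespace AdicCompletion

variable {P R : Type*} [CommRing P] [CommRing R]

/-- The maps from the completion of `P` to the quotients of `R` by powers of the extended ideal
which are induced by a ring homomorphism. -/
noncomputable def evalMap (φ : P →+* R) (J : Ideal P) (n : ℕ) :
    AdicCompletion J P →+* R ⧸ J.map φ ^ n :=
  (Ideal.quotientMap (J.map φ ^ n) φ (by rw [← Ideal.map_le_iff_le_comap, Ideal.map_pow])).comp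
    (evalₐ J n : _ →+* P ⧸ J ^ n)

lemma evalMap_mk (φ : P →+* R) (J : Ideal P) (f : AdicCauchySequence J P) (n : ℕ) :
    evalMap φ J n (mk J P f) = Ideal.Quotient.mk _ (φ (f n)) := by
  simp only [evalMap, RingHom.comp_apply, RingHom.coe_coe, evalₐ_mk, Ideal.quotientMap_mk]

lemma factorPow_comp_evalMap (φ : P →+* R) (J : Ideal P) {m n : ℕ} (hmn : m ≤ n) :
    (Ideal.Quotient.factorPow (J.map φ) hmn).comp (evalMap φ J n) = evalMap φ J m := by
  ext x
  induction x using AdicCompletion.induction_on with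
  | h f =>
    rw [RingHom.comp_apply, evalMap_mk, evalMap_mk]
    exact congrArg (Ideal.quotientMap (J.map φ ^ m) φ
      (by rw [← Ideal.map_le_iff_le_comap, Ideal.map_pow])) (AdicCompletion.Ideal.mk_eq_mk J hmn f)

/-- The map of completions induced by a ring homomorphism. -/
noncomputable def mapRingHom (φ : P →+* R) (J : Ideal P) :
    AdicCompletion J P →+* AdicCompletion (J.map φ) R :=
  liftRingHom (J.map φ) (evalMap φ J) (factorPow_comp_evalMap φ J)

lemma evalₐ_mapRingHom_mk (φ : P →+* R) (J : Ideal P) (f : AdicCauchySequence J P) (n : ℕ) :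
    evalₐ (J.map φ) n (mapRingHom φ J (mk J P f)) = Ideal.Quotient.mk _ (φ (f n)) :=
  (evalₐ_liftRingHom _ _ (factorPow_comp_evalMap φ J) n _).trans (evalMap_mk φ J f n)

lemma mapRingHom_surjective {φ : P →+* R} (hφ : Function.Surjective φ) (J : Ideal P) :
    Function.Surjective (mapRingHom φ J) := by
  intro y
  induction y using AdicCompletion.induction_on with
  | h f =>
    -- Lifting the successive differences into `Jⁿ`, rather than the terms themselves, keeps the
    -- lifted sequence Cauchy.
    have hδ (n : ℕ) : ∃ δ ∈ J ^ n, φ δ = f (n + 1) - f n := by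
      have h1 := AdicCauchySequence.mk_eq_mk n.le_succ f
      have h2 : f (n + 1) - f n ∈ (J ^ n).map φ := by
        rw [Ideal.map_pow]
        simpa using! (Submodule.Quotient.eq _).mp h1
      exact (Ideal.mem_map_iff_of_surjective φ hφ).mp h2
    choose δ hδJ hδ using hδ
    obtain ⟨p, hp⟩ := hφ (f 0)
    let g : AdicCauchySequence J P :=
      AdicCauchySequence.mk J P (fun n ↦ p + ∑ i ∈ Finset.range n, δ i) fun n ↦ by
        rw [SModEq.comm, SModEq.sub_mem, Finset.sum_range_succ, ← add_assoc, add_sub_cancel_left]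
        simpa using hδJ n
    refine ⟨mk J P g, ext_evalₐ fun n ↦ ?_⟩
    rw [evalₐ_mapRingHom_mk, evalₐ_mk]
    congr 1
    change φ (p + ∑ i ∈ Finset.range n, δ i) = f n
    rw [map_add, map_sum, hp, Finset.sum_congr rfl fun i _ ↦ hδ i, Finset.sum_range_sub,
      add_sub_cancel]

/-- The completion of a Noetherian ring is Noetherian. -/
theorem isNoetherianRing [IsNoetherianRing R] (I : Ideal R) :
    IsNoetherianRing (AdicCompletion I R) := by
  obtain ⟨d, a, ha⟩ := Submodule.fg_iff_exists_fin_generating_family.mp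
    ((isNoetherianRing_iff_ideal_fg R).mp inferInstance I)
  -- Sending variables to generators of `I` presents the completion as a quotient of a power series
  -- ring.
  let φ : MvPolynomial (Fin d) R →+* R := (MvPolynomial.aeval a).toRingHom
  have hφ : Function.Surjective φ := fun r ↦ ⟨MvPolynomial.C r, by simp [φ]⟩
  have hmap : (MvPolynomial.idealOfVars (Fin d) R).map φ = I := by
    rw [Ideal.map_span, ← Set.range_comp, ← ha]
    congr 2
    ext i
    simp [φ]
  subst hmap
  have : IsNoetherianRing (AdicCompletion (MvPolynomial.idealOfVars (Fin d) R)
      (MvPolynomial (Fin d) R)) :=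
    isNoetherianRing_of_ringEquiv (MvPowerSeries (Fin d) R)
      (MvPowerSeries.toAdicCompletionAlgEquiv (Fin d) R).toRingEquiv
  exact isNoetherianRing_of_surjective _ _ _ (mapRingHom_surjective hφ _)

end AdicCompletion

end CompletionNoetherian

/-! ### Contraction from a regular algebra lies in the solid closure -/

section SolidClosure

lemma mem_ofList_map_iff {R S : Type*} [CommRing R] [CommRing S] [Algebra R S] {l : List R}
    {s : S} : s ∈ (Ideal.ofList l).map (algebraMap R S) ↔
      ∃ c : Fin l.length → S, ∑ i, c i * algebraMap R S l[i] = s := by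
  have h : (Ideal.ofList l).map (algebraMap R S) =
      Ideal.span (Set.range fun i : Fin l.length ↦ algebraMap R S l[i]) := by
    rw [Ideal.ofList, Ideal.map_span]
    congr 1
    ext y
    simp only [Set.mem_image, Set.mem_ofPred_eq, Set.mem_range, List.mem_iff_get]
    constructor
    · rintro ⟨_, ⟨i, rfl⟩, rfl⟩
      exact ⟨i, rfl⟩
    · rintro ⟨i, rfl⟩
      exact ⟨_, ⟨i, rfl⟩, rfl⟩
  rw [h, Ideal.span, Submodule.mem_span_range_iff_exists_fun]
  rfl

/-- The solid algebra in the definition of solid closure may be taken in any universe. -/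
lemma mem_domainSolidClosure_of_algebra {D : Type u} [CommRing D] {l : List D} {z : D}
    {S : Type v} [CommRing S] [Algebra D S] (hS : IsSolid D S)
    (hz : algebraMap D S z ∈ (Ideal.ofList l).map (algebraMap D S)) :
    z ∈ domainSolidClosure (Ideal.ofList l) := by
  obtain ⟨f, hf⟩ := hS
  obtain ⟨s, hs⟩ : ∃ s, f s ≠ 0 := by
    by_contra! hall
    exact hf (LinearMap.ext hall)
  obtain ⟨c, hc⟩ := mem_ofList_map_iff.mp hz
  -- The variable `none` goes to an element on which `f` is nonzero, the others to the coefficients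
  -- witnessing membership of `z`.
  let φ : MvPolynomial (Option (Fin l.length)) D →ₐ[D] S :=
    MvPolynomial.aeval fun o ↦ o.elim s c
  let ψ : (MvPolynomial (Option (Fin l.length)) D ⧸ RingHom.ker φ) →ₐ[D] S :=
    Ideal.kerLiftAlg φ
  have hψ : Function.Injective ψ := Ideal.kerLiftAlg_injective φ
  have hψX (o : Option (Fin l.length)) :
      ψ (Ideal.Quotient.mk _ (MvPolynomial.X o)) = o.elim s c := by
    change φ (MvPolynomial.X o) = _
    simp [φ]
  refine ⟨MvPolynomial (Option (Fin l.length)) D ⧸ RingHom.ker φ, inferInstance, inferInstance,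
    ⟨f ∘ₗ ψ.toLinearMap, fun h ↦ hs ?_⟩, ?_⟩
  · have h1 : f (ψ (Ideal.Quotient.mk _ (MvPolynomial.X none))) = 0 :=
      LinearMap.congr_fun h (Ideal.Quotient.mk _ (MvPolynomial.X none))
    rwa [hψX] at h1
  · refine mem_ofList_map_iff.mpr ⟨fun i ↦ Ideal.Quotient.mk _ (MvPolynomial.X (some i)), hψ ?_⟩
    rw [map_sum, AlgHom.commutes, ← hc]
    refine Finset.sum_congr rfl fun i _ ↦ ?_
    rw [map_mul, hψX, AlgHom.commutes]
    rfl

lemma domainSolidClosure_map_ringEquiv {D D' : Type u} [CommRing D] [CommRing D'] (e : D ≃+* D')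
    {I : Ideal D} {z : D} (hz : z ∈ domainSolidClosure I) :
    e z ∈ domainSolidClosure (I.map (e : D →+* D')) := by
  obtain ⟨S, _, _, ⟨f, hf⟩, hzS⟩ := hz
  let _ : Algebra D' S := ((algebraMap D S).comp (e.symm : D' →+* D)).toAlgebra
  have halg (d : D') : algebraMap D' S d = algebraMap D S (e.symm d) := rfl
  refine ⟨S, inferInstance, inferInstance, ⟨{
    toFun := fun s ↦ e (f s)
    map_add' := by simp
    map_smul' := fun d s ↦ by
      have : d • s = e.symm d • s := by rw [Algebra.smul_def, Algebra.smul_def, halg]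
      rw [this, map_smul, smul_eq_mul, map_mul, e.apply_symm_apply]
      rfl }, fun h ↦ hf ?_⟩, ?_⟩
  · ext s
    exact e.injective ((LinearMap.congr_fun h s).trans (map_zero e).symm)
  · rw [halg, e.symm_apply_apply, Ideal.map_map]
    convert hzS using 2
    ext d
    simp [halg]

variable {R : Type u} [CommRing R] [IsLocalRing R] [IsNoetherianRing R]

/-- Let the completion of `R` be a domain and let a system of parameters be regular on the algebra
`B`. Then the contraction of the parameter ideal from `B` is contained in its solid closure. -/
theorem mem_solidClosure_of_isRegular (hirr : IsAnalyticallyIrreducible R) {l : List R}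
    (hl : IsSystemOfParameters R l) {B : Type v} [CommRing B] [Algebra R B]
    (hB : IsRegular B l) {z : R}
    (hz : algebraMap R B z ∈ (Ideal.ofList l).map (algebraMap R B)) :
    z ∈ solidClosure (Ideal.ofList l) := by
  let D := AdicCompletion (maximalIdeal R) R
  have : IsDomain D := hirr
  have : IsNoetherianRing D := AdicCompletion.isNoetherianRing _
  have : Module.FaithfullyFlat R D := Module.FaithfullyFlat.of_flat_of_isLocalHom
  have hmax : maximalIdeal D = (Ideal.ofList l).radical.map (algebraMap R D) := by
    rw [hl.2]
    exact AdicCompletion.maximalIdeal_eq_map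
  have hrad : (Ideal.ofList (l.map (algebraMap R D))).radical = maximalIdeal D := by
    rw [← Ideal.map_ofList]
    refine le_antisymm ?_ ?_
    · refine (maximalIdeal.isMaximal D).isPrime.radical_le_iff.mpr ?_
      rw [hmax]
      exact Ideal.map_mono Ideal.le_radical
    · rw [hmax]
      exact Ideal.map_radical_le _
  -- Only this inequality is needed, and the height theorem gives it.
  have hdim : ringKrullDim D ≤ (l.map (algebraMap R D)).length := by
    classical
    rw [← maximalIdeal_height_eq_ringKrullDim]
    have h1 : (maximalIdeal D).height ≤ ((l.map (algebraMap R D)).toFinset.card : ℕ∞) := by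
      refine Ideal.height_le_card_of_mem_minimalPrimes_span_finset ?_
      have h2 : Ideal.span ((l.map (algebraMap R D)).toFinset : Set D) =
          Ideal.ofList (l.map (algebraMap R D)) := by
        rw [Ideal.ofList, List.coe_toFinset]
      rw [h2, ← Ideal.radical_minimalPrimes, hrad, Ideal.minimalPrimes_eq_subsingleton_self]
      rfl
    exact_mod_cast h1.trans (by exact_mod_cast List.toFinset_card_le _)
  -- Faithful flatness of the completion keeps the sequence regular, including properness.
  have hreg : IsRegular (TensorProduct R D B) (l.map (algebraMap R D)) :=
    hB.of_faithfullyFlat_of_isBaseChange (TensorProduct.isBaseChange R B D)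
  have hsolid : IsSolid D (TensorProduct R D B) :=
    exists_linearForm_ne_zero_of_isRegular.{u, v} hrad hdim _ hreg
  have hmem : algebraMap R D z ∈ domainSolidClosure (Ideal.ofList (l.map (algebraMap R D))) := by
    refine mem_domainSolidClosure_of_algebra hsolid ?_
    rw [← Ideal.map_ofList, Ideal.map_map, ← IsScalarTower.algebraMap_eq,
      ← IsScalarTower.algebraMap_apply]
    let i : B →ₐ[R] TensorProduct R D B := Algebra.TensorProduct.includeRight
    have h1 := Ideal.mem_map_of_mem (i : B →+* TensorProduct R D B) hz
    rwa [Ideal.map_map, AlgHom.comp_algebraMap, RingHom.coe_coe, AlgHom.commutes] at h1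
  intro P hP
  have hP' : P = ⊥ := by
    rw [IsDomain.minimalPrimes_eq_singleton_bot] at hP
    exact hP
  subst hP'
  have h1 := domainSolidClosure_map_ringEquiv (RingEquiv.quotientBot D).symm hmem
  rw [← Ideal.map_ofList, Ideal.map_map] at h1
  exact h1

end SolidClosure

/-! ### Descent of regularity to `R` -/

section CohenMacaulay

variable {R : Type u} [CommRing R] [IsLocalRing R] [IsNoetherianRing R]

/-- Let a sequence in the maximal ideal be regular on the algebra `B`. If the ideal which it
generates is contracted from `B`, then so are the ideals generated by its initial segments. -/
lemma mem_ofList_of_algebraMap_mem {B : Type v} [CommRing B] [Algebra R B] (l r : List R)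
    (hm : ∀ x ∈ r, x ∈ maximalIdeal R) (hB : IsWeaklyRegular B (l ++ r))
    (h : ∀ z : R, algebraMap R B z ∈ (Ideal.ofList (l ++ r)).map (algebraMap R B) →
      z ∈ Ideal.ofList (l ++ r)) {z : R}
    (hz : algebraMap R B z ∈ (Ideal.ofList l).map (algebraMap R B)) : z ∈ Ideal.ofList l := by
  induction r generalizing l z with
  | nil => simpa using h z (by simpa using hz)
  | cons y r ih =>
    have hB' : IsWeaklyRegular B ((l ++ [y]) ++ r) := by simpa using! hB
    have hly (z : R) (hz : algebraMap R B z ∈ (Ideal.ofList (l ++ [y])).map (algebraMap R B)) :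
        z ∈ Ideal.ofList (l ++ [y]) :=
      ih (l ++ [y]) (fun x hx ↦ hm x (List.mem_cons_of_mem y hx)) hB' (by simpa using! h) hz
    have hy : IsSMulRegular (B ⧸ (Ideal.ofList l • ⊤ : Submodule R B)) y := by
      rw [isWeaklyRegular_append_iff, isWeaklyRegular_cons_iff] at hB
      exact hB.2.1
    let K := ((Ideal.ofList l).map (algebraMap R B)).comap (algebraMap R B)
    -- An element of the contraction `K` has the form `j + a y`. Regularity of `y` on `B` modulo `l`
    -- puts `a` back in `K`, so Nakayama applies.
    have hK : K ≤ Ideal.ofList l ⊔ maximalIdeal R • K := by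
      intro z hz
      have hz' : z ∈ Ideal.ofList (l ++ [y]) := by
        refine hly z (Ideal.map_mono ?_ hz)
        rw [Ideal.ofList_append]
        exact le_sup_left
      rw [Ideal.ofList_append, Ideal.ofList_singleton] at hz'
      obtain ⟨j, hj, w, hw, rfl⟩ := Submodule.mem_sup.mp hz'
      obtain ⟨a, rfl⟩ := Ideal.mem_span_singleton'.mp hw
      have hyK : a * y ∈ K := by
        have hjK : j ∈ K := Ideal.mem_map_of_mem _ hj
        simpa using! K.sub_mem hz hjK
      have haK : a ∈ K := by
        have hmem (b : R) : b ∈ K ↔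
            (Submodule.Quotient.mk (algebraMap R B b) :
              B ⧸ (Ideal.ofList l • ⊤ : Submodule R B)) = 0 := by
          rw [Submodule.Quotient.mk_eq_zero, Ideal.smul_top_eq_map]
          rfl
        rw [hmem] at hyK ⊢
        refine hy.right_eq_zero_of_smul ?_
        rw [← hyK, ← Submodule.Quotient.mk_smul]
        congr 1
        rw [Algebra.smul_def, map_mul, mul_comm]
      refine Submodule.add_mem_sup hj ?_
      rw [mul_comm]
      exact Submodule.smul_mem_smul (hm y List.mem_cons_self) haK
    exact Submodule.le_of_le_smul_of_le_jacobson_bot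
      ((isNoetherianRing_iff_ideal_fg R).mp inferInstance K)
      (maximalIdeal_le_jacobson ⊥) hK hz

/-- If an entry times `a` lies in the ideal of its predecessors, regularity on `B` puts `a` in the
extension of that ideal, which is contracted. -/
lemma isWeaklyRegular_of_contracted {B : Type v} [CommRing B] [Algebra R B] {l : List R}
    (hm : ∀ x ∈ l, x ∈ maximalIdeal R) (hB : IsWeaklyRegular B l)
    (h : ∀ z : R, algebraMap R B z ∈ (Ideal.ofList l).map (algebraMap R B) →
      z ∈ Ideal.ofList l) : IsWeaklyRegular R l := by
  rw [isWeaklyRegular_iff_Fin] at hB ⊢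
  intro i
  rw [isSMulRegular_iff_right_eq_zero_of_smul]
  intro q hq
  obtain ⟨a, rfl⟩ := Submodule.Quotient.mk_surjective _ q
  rw [← Submodule.Quotient.mk_smul, Submodule.Quotient.mk_eq_zero, smul_eq_mul, smul_eq_mul,
    Ideal.mul_top] at hq
  rw [Submodule.Quotient.mk_eq_zero, smul_eq_mul, Ideal.mul_top]
  have happ := List.take_append_drop i l
  refine mem_ofList_of_algebraMap_mem (B := B) (l.take i) (l.drop i)
    (fun x hx ↦ hm x (List.mem_of_mem_drop hx)) ?_ (by rwa [happ]) ?_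
  · rw [happ, isWeaklyRegular_iff_Fin]
    exact hB
  · have h1 : (Submodule.Quotient.mk (algebraMap R B a) :
        B ⧸ (Ideal.ofList (l.take i) • ⊤ : Submodule R B)) = 0 := by
      refine (hB i).right_eq_zero_of_smul ?_
      rw [← Submodule.Quotient.mk_smul, Submodule.Quotient.mk_eq_zero, Ideal.smul_top_eq_map,
        Algebra.smul_def, ← map_mul]
      exact Ideal.mem_map_of_mem _ hq
    rwa [Submodule.Quotient.mk_eq_zero, Ideal.smul_top_eq_map] at h1

lemma length_le_ringKrullDim_of_isRegular {l : List R} (h : IsRegular R l) :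
    (l.length : WithBot ℕ∞) ≤ ringKrullDim R := by
  have hne : Nontrivial (R ⧸ Ideal.ofList l) := by
    rw [Ideal.Quotient.nontrivial_iff]
    simpa using! h.top_ne_smul.symm
  rw [← ringKrullDim_add_length_eq_ringKrullDim_of_isRegular l h]
  exact le_add_of_nonneg_left ringKrullDim_nonneg_of_nontrivial

lemma isCohenMacaulayLocalRing_of_isRegular {l : List R} (hl : IsSystemOfParameters R l)
    (h : IsRegular R l) : IsCohenMacaulayLocalRing R := by
  refine ⟨inferInstance, ?_⟩
  rw [← hl.1]
  refine congrArg _ (le_antisymm (iSup_le fun xs ↦ ?_) ?_)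
  · have := length_le_ringKrullDim_of_isRegular xs.2.2
    rw [← hl.1] at this
    exact_mod_cast this
  · exact le_iSup (fun xs : {xs : List R // (∀ x ∈ xs, x ∈ maximalIdeal R) ∧
      IsRegular R xs} ↦ (xs.1.length : ℕ∞)) ⟨l, fun x hx ↦ hl.mem_maximalIdeal hx, h⟩

end CohenMacaulay

theorem propositionP {R : Type u} [CommRing R] [IsLocalRing R] [IsNoetherianRing R]
    (hirr : IsAnalyticallyIrreducible R) (hS : IsWeaklySRational R)
    (hB : ∃ (B : Type v) (_ : CommRing B) (_ : Algebra R B), IsBigCohenMacaulayAlgebra R B) :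
    IsCohenMacaulayLocalRing R := by
  obtain ⟨_, ⟨ys, hys, rfl⟩, hclosed⟩ := hS
  obtain ⟨B₀, _, _, xs, hxs, hB₀⟩ := hB
  obtain ⟨B, _, _, hB⟩ := HasRegularAlgebra.of_isSystemOfParameters.{u, v} hxs hys
    ⟨B₀, inferInstance, inferInstance, hB₀⟩
  have hm : ∀ y ∈ ys, y ∈ maximalIdeal R := fun y hy ↦ hys.mem_maximalIdeal hy
  have hreg : IsWeaklyRegular R ys := isWeaklyRegular_of_contracted hm hB.toIsWeaklyRegular
    fun z hz ↦ hclosed.le (mem_solidClosure_of_isRegular hirr hys hB hz)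
  exact isCohenMacaulayLocalRing_of_isRegular hys
    (IsRegular.of_isWeaklyRegular_of_mem_maximalIdeal R hm hreg)
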